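/- Let $k\ge 1$ and let $\Lambda$ be a finite $k$-graph with no sources: a countable small category with a degree functor $d:\Lambda\to\mathbb N^k$ such that every morphism (path) $\lambda$ with $d(\lambda)=m+n$ factors uniquely as $\lambda=\mu\nu$ with $d(\mu)=m$, $d(\nu)=n$; every $\Lambda^n=d^{-1}(n)$ is finite; and for all vertices $v$ and all $n\in\mathbb N^k$ the set $v\Lambda^n$ of paths of degree $n$ with range $v$ is nonempty. Write $r,s$ for range and source, $\Lambda^0$ for the set of vertices, and $e_1,\dots,e_k$ for the standard basis of $\mathbb N^k$; the elements of the sets $\Lambda^{e_i}$ are called edges. Let $C^*(\Lambda)$ be the universal $C^*$-algebra generated by a Cuntz--Krieger $\Lambda$-family, that is, by partial isometries $\{t_\lambda\}_{\lambda\in\Lambda}$ such that $\{t_v\}_{v\in\Lambda^0}$ are mutually orthogonal projections, $t_\lambda t_\eta=t_{\lambda\eta}$ if $s(\lambda)=r(\eta)$, $t_\lambda^*t_\lambda=t_{s(\lambda)}$, and $t_v=\sum_{\lambda\in v\Lambda^n}t_\lambda t_\lambda^*$ for all $v\in\Lambda^0$, $n\in\mathbb N^k$. Let $(X,\mathcal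 F,\mu)$ be a measure space. For each $1\le i\le k$ let $\{\tau_f:D_f\to R_f\}_{f\in\Lambda^{e_i}}$ be a semibranching function system on $(X,\mu)$ with coding map $\tau^{e_i}:X\to X$. This means: the $D_f\subset X$ are measurable, the maps $\tau_f:D_f\to X$ are measurable with range $R_f=\tau_f(D_f)$, and they map measurable sets to measurable sets; $\mu(X\setminus\bigcup_{f\in\Lambda^{e_i}}R_f)=0$ and $\mu(R_f\cap R_g)=0$ for $f\ne g$ in $\Lambda^{e_i}$; the measure $\mu\circ\tau_f$ on $D_f$ has a (finite-valued, measurable) Radon--Nikodym derivative $\Phi_{\tau_f}=\frac{d(\mu\circ\tau_f)}{d\mu}$ with $\Phi_{\tau_f}>0$ $\mu$-a.e. on $D_f$; and $\tau^{e_i}$ is measurable with $\tau^{e_i}(\tau_f(x))=x$ for all $x\in D_f$. Suppose that there are sets $D_v\subset X$, $v\in\Lambda^0$, such that: (i) $D_f=D_{s(f)}$ for every edge $f$, and $\mu(D_v)>0$ for every $v\in\Lambda^0$; (ii) $\mu(D_v\cap D_w)=0$ for $v\ne w$ in $\Lambda^0$; (iii) for all $i,j\in\{1,\dots,k\}$,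 if $\lambda\alpha=\nu\beta$ with $\lambda,\beta\in\Lambda^{e_i}$ and $\nu,\alpha\in\Lambda^{e_j}$, then $R_\alpha\subset D_\lambda$, $R_\beta\subset D_\nu$ and $\tau_\lambda\circ\tau_\alpha=\tau_\nu\circ\tau_\beta$; (iv) $\tau^{e_i}\circ\tau^{e_j}=\tau^{e_j}\circ\tau^{e_i}$ for all $i,j$; (v) $\mu\bigl(D_v\setminus\bigcup_{g\in v\Lambda^{e_i}}R_g\bigr)=0$ for all $v\in\Lambda^0$ and $1\le i\le k$. Then for each $1\le i\le k$ and $f\in\Lambda^{e_i}$ the formula $$S_f\xi(x)=\chi_{R_f}(x)\,\bigl(\Phi_{\tau_f}(\tau^{e_i}(x))\bigr)^{-1/2}\,\xi(\tau^{e_i}(x))$$ defines a bounded operator $S_f\in B(L^2(X,\mu))$, and the operators $\{S_f: f\in\Lambda^{e_i},\,1\le i\le k\}$ generate a representation of $C^*(\Lambda)$ on $L^2(X,\mu)$: there is a unique $*$-homomorphism $\pi:C^*(\Lambda)\to B(L^2(X,\mu))$ with $\pi(t_f)=S_f$ for every edge $f$, and the closure of $\pi(C^*(\Lambda))$ is the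 $C^*$-algebra generated by the operators $S_f$. -/

import Mathlib

open CategoryTheory MeasureTheory
open scoped ENNReal

universe u v w

noncomputable section

/-! ### Higher-rank graphs

A morphism `f : a ⟶ b` of the category is a path with source `s(f) = a` and range `r(f) = b`, so
the path written `f g` (with `s(f) = r(g)`) in the graph literature is `g ≫ f` here.
`Arrow Λ` is the set of all paths; for `f : Arrow Λ`, the source is `f.left`, the range `f.right`. -/

/-- A `k`-graph: a countable small category with a degree functor to `ℕ^k` that satisfies the
factorization property. -/
structure HigherRankGraph (k : ℕ) (Λ : Type u) [Category.{v} Λ] where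
  /-- the degree of a path -/
  deg : Arrow Λ → Fin k → ℕ
  countable : Countable (Arrow Λ)
  deg_id : ∀ a : Λ, deg (Arrow.mk (𝟙 a)) = 0
  deg_comp : ∀ {a b c : Λ} (g : a ⟶ b) (f : b ⟶ c),
    deg (Arrow.mk (g ≫ f)) = deg (Arrow.mk f) + deg (Arrow.mk g)
  factorization : ∀ {a c : Λ} (h : a ⟶ c) (m n : Fin k → ℕ), deg (Arrow.mk h) = m + n →
    ∃! p : Σ b : Λ, (a ⟶ b) × (b ⟶ c),
      p.2.1 ≫ p.2.2 = h ∧ deg (Arrow.mk p.2.2) = m ∧ deg (Arrow.mk p.2.1) = n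

namespace HigherRankGraph

variable {k : ℕ} {Λ : Type u} [Category.{v} Λ]

/-- The standard basis vector `e_i` of `ℕ^k`. -/
def basisVec (i : Fin k) : Fin k → ℕ := Pi.single i 1

/-- `Λ^n`, the set of paths of degree `n`. -/
def pathsOfDeg (G : HigherRankGraph k Λ) (n : Fin k → ℕ) : Set (Arrow Λ) := {f | G.deg f = n}

/-- `aΛ^n`, the set of paths of degree `n` with range `a`. -/
def pathsInto (G : HigherRankGraph k Λ) (a : Λ) (n : Fin k → ℕ) : Set (Arrow Λ) :=
  {f | f.right = a ∧ G.deg f = n}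

/-- `Λ^{e_i}`, the edges of colour `i`. -/
abbrev Edge (G : HigherRankGraph k Λ) (i : Fin k) : Type (max u v) := G.pathsOfDeg (basisVec i)

/-- `Λ` is finite: every `Λ^n` is a finite set. -/
def IsFinite (G : HigherRankGraph k Λ) : Prop := ∀ n : Fin k → ℕ, (G.pathsOfDeg n).Finite

/-- `Λ` has no sources: every `aΛ^n` is nonempty. -/
def NoSources (G : HigherRankGraph k Λ) : Prop :=
  ∀ (a : Λ) (n : Fin k → ℕ), (G.pathsInto a n).Nonempty

/-! ### Cuntz–Krieger families and `C*(Λ)` -/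

/-- Cuntz–Krieger `Λ`-families in a C*-algebra, for a row-finite `Λ` (so that the sum in `ck4` is
a finite sum). -/
structure IsCKFamily (G : HigherRankGraph k Λ) {A : Type w} [NonUnitalCStarAlgebra A]
    (t : Arrow Λ → A) : Prop where
  partialIsometry : ∀ f, t f * star (t f) * t f = t f
  ck1_proj : ∀ a : Λ, IsStarProjection (t (Arrow.mk (𝟙 a)))
  ck1_orth : ∀ a b : Λ, a ≠ b → t (Arrow.mk (𝟙 a)) * t (Arrow.mk (𝟙 b)) = 0
  ck2 : ∀ {a b c : Λ} (g : a ⟶ b) (f : b ⟶ c),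
    t (Arrow.mk f) * t (Arrow.mk g) = t (Arrow.mk (g ≫ f))
  ck3 : ∀ {a b : Λ} (f : a ⟶ b), star (t (Arrow.mk f)) * t (Arrow.mk f) = t (Arrow.mk (𝟙 a))
  ck4 : ∀ (a : Λ) (n : Fin k → ℕ),
    t (Arrow.mk (𝟙 a)) = ∑ᶠ f ∈ G.pathsInto a n, t f * star (t f)

/-- A C*-algebra (in the universe `w`) together with a Cuntz–Krieger `Λ`-family in it. -/
structure CKPair (G : HigherRankGraph k Λ) where
  /-- the C*-algebra -/
  alg : Type w
  [cstar : NonUnitalCStarAlgebra alg]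
  /-- the family -/
  fam : Arrow Λ → alg
  isCK : G.IsCKFamily fam

attribute [instance] CKPair.cstar

theorem norm_le_one_of_partialIsometry {A : Type w} [NonUnitalCStarAlgebra A] {x : A}
    (hx : x * star x * x = x) : ‖x‖ ≤ 1 := by
  have h1 : ‖x * star x‖ * ‖x * star x‖ = ‖x * star x‖ := by
    have h2 : (x * star x) * star (x * star x) = x * star x := by
      rw [star_mul, star_star, ← mul_assoc, hx]
    rw [← CStarRing.norm_self_mul_star (x := x * star x), h2]
  rw [CStarRing.norm_self_mul_star] at h1
  by_contra! h
  nlinarith [mul_pos (sub_pos.mpr h) (lt_trans one_pos h),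
    mul_pos (lt_trans one_pos h) (lt_trans one_pos h)]

/-- The universal family: the tuple of all Cuntz–Krieger families, in the `ℓ^∞`-product of all the
C*-algebras that carry one. -/
def universalFamily (G : HigherRankGraph k Λ) (f : Arrow Λ) :
    lp (fun P : CKPair.{u, v, w} G => P.alg) ∞ :=
  ⟨fun P => P.fam f, memℓp_infty ⟨1, by
    rintro _ ⟨P, rfl⟩
    exact norm_le_one_of_partialIsometry (P.isCK.partialIsometry f)⟩⟩

/-- `C*(Λ)`, the universal C*-algebra generated by a Cuntz–Krieger `Λ`-family: the C*-algebra
generated by the universal family. It maps onto the C*-algebra generated by any Cuntz–Krieger family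
in any C*-algebra of `Type w`, by evaluation at the corresponding coordinate. (The algebra generated
by a Cuntz–Krieger family of a countable `Λ` is separable, so up to isomorphism the result does not
depend on `w`.) -/
def cstarSubalgebra (G : HigherRankGraph k Λ) :
    NonUnitalStarSubalgebra ℂ (lp (fun P : CKPair.{u, v, w} G => P.alg) ∞) :=
  (NonUnitalStarAlgebra.adjoin ℂ (Set.range G.universalFamily)).topologicalClosure

/-- `C*(Λ)` as a type. -/
abbrev CStarAlg (G : HigherRankGraph k Λ) : Type (max u v (w + 1)) :=
  cstarSubalgebra.{u, v, w} G

instance isClosed_cstarSubalgebra (G : HigherRankGraph k Λ) :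
    IsClosed (cstarSubalgebra.{u, v, w} G : Set (lp (fun P : CKPair.{u, v, w} G => P.alg) ∞)) :=
  NonUnitalStarSubalgebra.isClosed_topologicalClosure _

/-- The generator `t_f` of `C*(Λ)`. -/
def gen (G : HigherRankGraph k Λ) (f : Arrow Λ) : CStarAlg.{u, v, w} G :=
  ⟨G.universalFamily f, NonUnitalStarSubalgebra.le_topologicalClosure _
    (NonUnitalStarAlgebra.subset_adjoin ℂ _ ⟨f, rfl⟩)⟩

end HigherRankGraph

/-! ### Semibranching function systems

A partial map `σ_j : D_j → X` is given by a function `σ j : X → X` whose values off `D j` play no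
role; its range is `R_j = σ j '' D j`. -/

/-- `Φ` is a Radon–Nikodym derivative `d(μ ∘ σ)/dμ` on `D`, where `(μ ∘ σ)(E) = μ(σ(E))` for
measurable `E ⊆ D`. It is finite-valued; no σ-finiteness is required. -/
structure IsRNDerivOn {X : Type u} [MeasurableSpace X] (μ : Measure X) (D : Set X) (σ : X → X)
    (Φ : X → ℝ) : Prop where
  measurable : Measurable Φ
  nonneg : ∀ x ∈ D, 0 ≤ Φ x
  measurableSet_image : ∀ E ⊆ D, MeasurableSet E → MeasurableSet (σ '' E)
  measure_image : ∀ E ⊆ D, MeasurableSet E → μ (σ '' E) = ∫⁻ x in E, ENNReal.ofReal (Φ x) ∂μ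

/-- The maps `σ_j : D_j → X` form a semibranching function system on `(X, μ)`, with Radon–Nikodym
derivatives `Φ_j`. -/
structure IsSemibranching {X : Type u} [MeasurableSpace X] (μ : Measure X) {ι : Type v}
    (D : ι → Set X) (σ : ι → X → X) (Φ : ι → X → ℝ) : Prop where
  measurableSet_dom : ∀ j, MeasurableSet (D j)
  measurable_map : ∀ j, Measurable ((D j).domRestrict (σ j))
  cover : μ (⋃ j, σ j '' D j)ᶜ = 0
  disjoint : ∀ j l, j ≠ l → μ (σ j '' D j ∩ σ l '' D l) = 0
  rnDeriv : ∀ j, IsRNDerivOn μ (D j) (σ j) (Φ j)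
  rnDeriv_pos : ∀ j, ∀ᵐ x ∂μ, x ∈ D j → 0 < Φ j x

/-- `c : X → X` is a coding map for the family `σ_j : D_j → X`. -/
structure IsCodingMap {X : Type u} [MeasurableSpace X] {ι : Type v}
    (D : ι → Set X) (σ : ι → X → X) (c : X → X) : Prop where
  measurable : Measurable c
  apply_map : ∀ j, ∀ x ∈ D j, c (σ j x) = x

/-- For every colour `i`, the maps `τ_f : D_f → X`, `f ∈ Λ^{e_i}`, form a semibranching function
system with coding map `c i = τ^{e_i}`, and together they satisfy the compatibility conditions
(i)–(v). The set `DV a` is `D_a` for the vertex `a`. -/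
structure IsEdgeSemibranching {k : ℕ} {Λ : Type u} [Category.{v} Λ] (G : HigherRankGraph k Λ)
    {X : Type w} [MeasurableSpace X] (μ : Measure X)
    (D : ∀ i, G.Edge i → Set X) (τ : ∀ i, G.Edge i → X → X) (Φ : ∀ i, G.Edge i → X → ℝ)
    (c : Fin k → X → X) (DV : Λ → Set X) : Prop where
  semibranching : ∀ i, IsSemibranching μ (D i) (τ i) (Φ i)
  coding : ∀ i, IsCodingMap (D i) (τ i) (c i)
  /-- (i), first part: `D_f` only depends on the source of the edge `f`. -/
  cond_i_dom : ∀ i (f : G.Edge i), D i f = DV f.1.left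
  /-- (i), second part. -/
  cond_i_pos : ∀ a, 0 < μ (DV a)
  cond_ii : ∀ a b, a ≠ b → μ (DV a ∩ DV b) = 0
  /-- (iii): here `lam α = ν β` as paths, where `lam, β` have colour `i` and `ν, α` colour `j`. -/
  cond_iii : ∀ (i j : Fin k) {a b b' d : Λ} (lam : b ⟶ d) (α : a ⟶ b) (ν : b' ⟶ d) (β : a ⟶ b')
    (hlam : Arrow.mk lam ∈ G.pathsOfDeg (HigherRankGraph.basisVec i))
    (hα : Arrow.mk α ∈ G.pathsOfDeg (HigherRankGraph.basisVec j))
    (hν : Arrow.mk ν ∈ G.pathsOfDeg (HigherRankGraph.basisVec j))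
    (hβ : Arrow.mk β ∈ G.pathsOfDeg (HigherRankGraph.basisVec i)),
    α ≫ lam = β ≫ ν →
      τ j ⟨_, hα⟩ '' D j ⟨_, hα⟩ ⊆ D i ⟨_, hlam⟩ ∧
      τ i ⟨_, hβ⟩ '' D i ⟨_, hβ⟩ ⊆ D j ⟨_, hν⟩ ∧
      ∀ x ∈ D j ⟨_, hα⟩, τ i ⟨_, hlam⟩ (τ j ⟨_, hα⟩ x) = τ j ⟨_, hν⟩ (τ i ⟨_, hβ⟩ x)
  cond_iv : ∀ i j, c i ∘ c j = c j ∘ c i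
  cond_v : ∀ (a : Λ) (i : Fin k),
    μ (DV a \ ⋃ g : {g : G.Edge i // g.1.right = a}, τ i g.1 '' D i g.1) = 0

end

/-! A partial bijection `e` that is nonsingular with density `Φ = d(μ ∘ e)/dμ` acts on `L²` by
`ξ ↦ Φ ^ (-1/2) • ξ` transported along `e`. Composition of partial bijections becomes composition of
operators, inversion becomes the adjoint, and the operator only depends on the restriction of `e` to
its source. The Cuntz–Krieger relations between edges are therefore relations between partial
bijections: commuting squares by (iii), and by (v) an almost everywhere partition of the domain of a
vertex by the ranges of the edges of one colour into it.

A path is a product of edges, and two factorizations into edges differ by commuting squares. Hence a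
family of operators indexed by the edges that commutes on squares extends to all paths, and the
sum relations for all degrees follow from those for the basis vectors. Conversely, the projection at
a vertex is a sum of elements `t_f * star t_f` over edges `f`, so the edges generate `C*(Λ)` and a
representation is determined by its values on them. -/

/-! ### Nonsingular partial bijections -/

section PartialBijections

theorem measurableSet_inter_preimage {X Y : Type*} [MeasurableSpace X] [MeasurableSpace Y]
    {s : Set X} {f : X → Y} (hs : MeasurableSet s) (hf : Measurable (s.domRestrict f))
    {t : Set Y} (ht : MeasurableSet t) : MeasurableSet (s ∩ f ⁻¹' t) := by
  rw [← Subtype.image_preimage_coe]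
  exact hs.subtype_image (hf ht)

/-- A partial bijection `e` between measure spaces which, together with its inverse, is measurable
and preserves null sets: `Φ` is the strictly positive, finite-valued density `d(ν ∘ e)/dμ` on the
source of `e`. It is encoded by the push-forward of `ν` under `e.symm`, so that no σ-finiteness is
needed, and the values of `Φ`, `e` and `e.symm` outside the source and the target play no role. -/
structure IsNonsingular {X Y : Type*} [MeasurableSpace X] [MeasurableSpace Y] (μ : Measure X)
    (ν : Measure Y) (e : PartialEquiv X Y) (Φ : X → ℝ) : Prop where
  measurableSet_source : MeasurableSet e.source
  measurableSet_target : MeasurableSet e.target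
  measurable_toFun : Measurable (e.source.domRestrict e)
  measurable_symm : Measurable (e.target.domRestrict e.symm)
  aemeasurable_deriv : AEMeasurable Φ (μ.restrict e.source)
  deriv_pos : ∀ᵐ x ∂μ.restrict e.source, 0 < Φ x
  map_symm : (ν.restrict e.target).map e.symm =
    (μ.restrict e.source).withDensity fun x => ENNReal.ofReal (Φ x)

namespace IsNonsingular

variable {X Y Z : Type*} [MeasurableSpace X] [MeasurableSpace Y] [MeasurableSpace Z]
  {μ : Measure X} {ν : Measure Y} {ρ : Measure Z} {e : PartialEquiv X Y} {Φ : X → ℝ}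
  {e' : PartialEquiv Y Z} {Ψ : Y → ℝ}

theorem aemeasurable (h : IsNonsingular μ ν e Φ) : AEMeasurable e (μ.restrict e.source) :=
  aemeasurable_restrict_of_measurable_subtype h.measurableSet_source h.measurable_toFun

theorem aemeasurable_symm (h : IsNonsingular μ ν e Φ) :
    AEMeasurable e.symm (ν.restrict e.target) :=
  aemeasurable_restrict_of_measurable_subtype h.measurableSet_target h.measurable_symm

theorem map_symm_absolutelyContinuous (h : IsNonsingular μ ν e Φ) :
    (ν.restrict e.target).map e.symm ≪ μ.restrict e.source :=
  h.map_symm ▸ withDensity_absolutelyContinuous _ _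

theorem ae_comp_symm (h : IsNonsingular μ ν e Φ) {p : X → Prop}
    (hp : ∀ᵐ x ∂μ.restrict e.source, p x) : ∀ᵐ y ∂ν.restrict e.target, p (e.symm y) :=
  ae_of_ae_map h.aemeasurable_symm (h.map_symm_absolutelyContinuous.ae_le hp)

theorem aemeasurable_comp_symm (h : IsNonsingular μ ν e Φ) {β : Type*} [MeasurableSpace β]
    {g : X → β} (hg : AEMeasurable g (μ.restrict e.source)) :
    AEMeasurable (fun y => g (e.symm y)) (ν.restrict e.target) :=
  (hg.mono_ac h.map_symm_absolutelyContinuous).comp_aemeasurable h.aemeasurable_symm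

theorem aestronglyMeasurable_comp_symm (h : IsNonsingular μ ν e Φ) {β : Type*}
    [TopologicalSpace β] {g : X → β} (hg : AEStronglyMeasurable g (μ.restrict e.source)) :
    AEStronglyMeasurable (fun y => g (e.symm y)) (ν.restrict e.target) :=
  (hg.mono_ac h.map_symm_absolutelyContinuous).comp_aemeasurable h.aemeasurable_symm

theorem lintegral_comp_symm (h : IsNonsingular μ ν e Φ) {g : X → ℝ≥0∞}
    (hg : AEMeasurable g (μ.restrict e.source)) :
    ∫⁻ y in e.target, g (e.symm y) ∂ν = ∫⁻ x in e.source, ENNReal.ofReal (Φ x) * g x ∂μ := by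
  rw [← lintegral_map' (hg.mono_ac h.map_symm_absolutelyContinuous) h.aemeasurable_symm,
    h.map_symm, lintegral_withDensity_eq_lintegral_mul₀ h.aemeasurable_deriv.ennreal_ofReal hg]
  rfl

theorem integral_comp_symm (h : IsNonsingular μ ν e Φ) {E : Type*} [NormedAddCommGroup E]
    [NormedSpace ℝ E] {g : X → E} (hg : AEStronglyMeasurable g (μ.restrict e.source)) :
    ∫ y in e.target, g (e.symm y) ∂ν = ∫ x in e.source, Φ x • g x ∂μ := by
  rw [← integral_map h.aemeasurable_symm (hg.mono_ac h.map_symm_absolutelyContinuous), h.map_symm,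
    integral_withDensity_eq_integral_toReal_smul₀ h.aemeasurable_deriv.ennreal_ofReal
      (ae_of_all _ fun _ => ENNReal.ofReal_lt_top)]
  refine integral_congr_ae (h.deriv_pos.mono fun x hx => ?_)
  simp only [ENNReal.toReal_ofReal hx.le]

protected theorem symm (h : IsNonsingular μ ν e Φ) :
    IsNonsingular ν μ e.symm fun y => (Φ (e.symm y))⁻¹ where
  measurableSet_source := h.measurableSet_target
  measurableSet_target := h.measurableSet_source
  measurable_toFun := h.measurable_symm
  measurable_symm := h.measurable_toFun
  aemeasurable_deriv := (h.aemeasurable_comp_symm h.aemeasurable_deriv).inv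
  deriv_pos := (h.ae_comp_symm h.deriv_pos).mono fun _ => inv_pos.mpr
  map_symm := by
    refine Measure.ext_of_lintegral _ fun f hf => ?_
    have hfe : AEMeasurable (fun x => f (e x)) (μ.restrict e.source) :=
      hf.comp_aemeasurable h.aemeasurable
    calc ∫⁻ y, f y ∂(μ.restrict e.source).map e
        = ∫⁻ x in e.source, f (e x) ∂μ := lintegral_map' hf.aemeasurable h.aemeasurable
      _ = ∫⁻ x in e.source, ENNReal.ofReal (Φ x) * (ENNReal.ofReal (Φ x)⁻¹ * f (e x)) ∂μ := by
        refine lintegral_congr_ae (h.deriv_pos.mono fun x hx => ?_)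
        simp only [← mul_assoc, ← ENNReal.ofReal_mul hx.le, mul_inv_cancel₀ hx.ne',
          ENNReal.ofReal_one, one_mul]
      _ = ∫⁻ y in e.target, ENNReal.ofReal (Φ (e.symm y))⁻¹ * f (e (e.symm y)) ∂ν :=
        (h.lintegral_comp_symm (h.aemeasurable_deriv.inv.ennreal_ofReal.mul hfe)).symm
      _ = ∫⁻ y in e.target, ENNReal.ofReal (Φ (e.symm y))⁻¹ * f y ∂ν :=
        setLIntegral_congr_fun h.measurableSet_target fun y hy => by simp only [e.right_inv hy]
      _ = ∫⁻ y, f y ∂(ν.restrict e.target).withDensity _ :=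
        (lintegral_withDensity_eq_lintegral_mul₀
          (h.aemeasurable_comp_symm h.aemeasurable_deriv).inv.ennreal_ofReal hf.aemeasurable).symm

theorem restr (h : IsNonsingular μ ν e Φ) {A : Set X} (hA : MeasurableSet (e.source ∩ A)) :
    IsNonsingular μ ν (e.restr A) Φ := by
  have h_target : e.target ∩ e.symm ⁻¹' A = e.target ∩ e.symm ⁻¹' (e.source ∩ A) := by
    ext y
    exact and_congr_right fun hy => (and_iff_right (e.map_target hy)).symm
  exact
    { measurableSet_source := hA
      measurableSet_target := by
        rw [PartialEquiv.restr_target, h_target]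
        exact measurableSet_inter_preimage h.measurableSet_target h.measurable_symm hA
      measurable_toFun :=
        h.measurable_toFun.comp (measurable_inclusion Set.inter_subset_left)
      measurable_symm :=
        h.measurable_symm.comp (measurable_inclusion Set.inter_subset_left)
      aemeasurable_deriv := h.aemeasurable_deriv.mono_set Set.inter_subset_left
      deriv_pos := ae_restrict_of_ae_restrict_of_subset Set.inter_subset_left h.deriv_pos
      map_symm := by
        have h_null := h.aemeasurable_symm.nullMeasurableSet_preimage hA
        simp only [PartialEquiv.restr_target, PartialEquiv.restr_source,
          PartialEquiv.restr_coe_symm]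
        rw [h_target, Set.inter_comm, ← Measure.restrict_restrict₀ h_null,
          ← Measure.restrict_map_of_aemeasurable h.aemeasurable_symm hA, h.map_symm,
          restrict_withDensity hA, Measure.restrict_restrict hA,
          Set.inter_eq_left.mpr Set.inter_subset_left] }

theorem measurableSet_trans_source (h : IsNonsingular μ ν e Φ) (h' : IsNonsingular ν ρ e' Ψ) :
    MeasurableSet (e.trans e').source :=
  measurableSet_inter_preimage h.measurableSet_source h.measurable_toFun h'.measurableSet_source

theorem measurable_trans (h : IsNonsingular μ ν e Φ) (h' : IsNonsingular ν ρ e' Ψ) :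
    Measurable ((e.trans e').source.domRestrict (e.trans e')) :=
  h'.measurable_toFun.comp
    ((h.measurable_toFun.comp (measurable_inclusion Set.inter_subset_left)).subtype_mk
      (h := fun x => x.2.2))

theorem aemeasurable_deriv_comp (h : IsNonsingular μ ν e Φ) (h' : IsNonsingular ν ρ e' Ψ) :
    AEMeasurable (fun x => Ψ (e x)) (μ.restrict (e.trans e').source) :=
  (h.symm.restr (h.measurableSet_target.inter h'.measurableSet_source)).aemeasurable_comp_symm
    (h'.aemeasurable_deriv.mono_set Set.inter_subset_right)

theorem aemeasurable_deriv_mul_deriv_comp (h : IsNonsingular μ ν e Φ)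
    (h' : IsNonsingular ν ρ e' Ψ) :
    AEMeasurable (fun x => Φ x * Ψ (e x)) (μ.restrict (e.trans e').source) :=
  (h.aemeasurable_deriv.mono_set Set.inter_subset_left).mul (h.aemeasurable_deriv_comp h')

theorem lintegral_comp_trans_symm (h : IsNonsingular μ ν e Φ) (h' : IsNonsingular ν ρ e' Ψ)
    {f : X → ℝ≥0∞} (hf : Measurable f) :
    ∫⁻ z in (e.trans e').target, f ((e.trans e').symm z) ∂ρ =
      ∫⁻ x in (e.trans e').source, ENNReal.ofReal (Φ x * Ψ (e x)) * f x ∂μ := by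
  have h_restr := h.restr (h.measurableSet_trans_source h')
  have h_middle := h'.measurableSet_source.inter h.measurableSet_target
  calc ∫⁻ z in e'.target ∩ e'.symm ⁻¹' e.target, f (e.symm (e'.symm z)) ∂ρ
    _ = ∫⁻ y in e'.source ∩ e.target, ENNReal.ofReal (Ψ y) * f (e.symm y) ∂ν :=
        (h'.restr h_middle).lintegral_comp_symm
          (hf.comp_aemeasurable (h.aemeasurable_symm.mono_set Set.inter_subset_right))
    _ = ∫⁻ y in e'.source ∩ e.target, ENNReal.ofReal (Ψ (e (e.symm y))) * f (e.symm y) ∂ν :=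
        setLIntegral_congr_fun h_middle fun y hy => by simp only [e.right_inv hy.2]
    _ = ∫⁻ y in e.target ∩ e.symm ⁻¹' (e ⁻¹' e'.source),
          ENNReal.ofReal (Ψ (e (e.symm y))) * f (e.symm y) ∂ν := by
        rw [e.target_inter_inv_preimage_preimage, Set.inter_comm]
    _ = ∫⁻ x in e.source ∩ e ⁻¹' e'.source,
          ENNReal.ofReal (Φ x) * (ENNReal.ofReal (Ψ (e x)) * f x) ∂μ :=
        h_restr.lintegral_comp_symm
          ((h.aemeasurable_deriv_comp h').ennreal_ofReal.mul hf.aemeasurable)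
    _ = ∫⁻ x in e.source ∩ e ⁻¹' e'.source, ENNReal.ofReal (Φ x * Ψ (e x)) * f x ∂μ :=
        lintegral_congr_ae (h_restr.deriv_pos.mono fun x hx => by
          simp only [ENNReal.ofReal_mul hx.le, mul_assoc])

protected theorem trans (h : IsNonsingular μ ν e Φ) (h' : IsNonsingular ν ρ e' Ψ) :
    IsNonsingular μ ρ (e.trans e') fun x => Φ x * Ψ (e x) where
  measurableSet_source := h.measurableSet_trans_source h'
  measurableSet_target := h'.symm.measurableSet_trans_source h.symm
  measurable_toFun := h.measurable_trans h'
  measurable_symm := h'.symm.measurable_trans h.symm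
  aemeasurable_deriv := h.aemeasurable_deriv_mul_deriv_comp h'
  deriv_pos := by
    have h_pos : ∀ᵐ x ∂μ.restrict (e.trans e').source, 0 < Φ x :=
      ae_restrict_of_ae_restrict_of_subset Set.inter_subset_left h.deriv_pos
    have h_pos' : ∀ᵐ x ∂μ.restrict (e.trans e').source, 0 < Ψ (e x) :=
      (h.symm.restr (h.measurableSet_target.inter h'.measurableSet_source)).ae_comp_symm
        (ae_restrict_of_ae_restrict_of_subset Set.inter_subset_right h'.deriv_pos)
    filter_upwards [h_pos, h_pos'] with x hx hx' using mul_pos hx hx'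
  map_symm := by
    have h_symm : AEMeasurable (e.trans e').symm (ρ.restrict (e.trans e').target) :=
      aemeasurable_restrict_of_measurable_subtype (h'.symm.measurableSet_trans_source h.symm)
        (h'.symm.measurable_trans h.symm)
    refine Measure.ext_of_lintegral _ fun f hf => ?_
    rw [lintegral_map' hf.aemeasurable h_symm, h.lintegral_comp_trans_symm h' hf,
      lintegral_withDensity_eq_lintegral_mul₀
        (h.aemeasurable_deriv_mul_deriv_comp h').ennreal_ofReal hf.aemeasurable]
    rfl

theorem ofSet {s : Set X} (hs : MeasurableSet s) :
    IsNonsingular μ μ (PartialEquiv.ofSet s) fun _ => 1 where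
  measurableSet_source := hs
  measurableSet_target := hs
  measurable_toFun := measurable_subtype_coe
  measurable_symm := measurable_subtype_coe
  aemeasurable_deriv := aemeasurable_const
  deriv_pos := ae_of_all _ fun _ => one_pos
  map_symm := by
    simp only [ENNReal.ofReal_one]
    exact Measure.map_id.trans withDensity_one.symm

end IsNonsingular
end PartialBijections

/-! ### Weighted composition operators -/

section WeightedComposition

/-- The weighted composition of functions along a partial bijection `e` with density `Φ`, extended
by zero outside the target of `e`. The weight turns a nonsingular `e` into an isometry of `L²` of
the source onto `L²` of the target. -/
noncomputable def weightedComp {X Y : Type*} (𝕜 : Type*) [RCLike 𝕜] (E : Type*)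
    [NormedAddCommGroup E] [NormedSpace 𝕜 E] (e : PartialEquiv X Y) (Φ : X → ℝ) :
    (X → E) →ₗ[𝕜] (Y → E) where
  toFun ξ := e.target.indicator fun y =>
    ((Φ (e.symm y) ^ (-(1 / 2) : ℝ) : ℝ) : 𝕜) • ξ (e.symm y)
  map_add' ξ η := by
    ext y
    by_cases hy : y ∈ e.target <;> simp [hy]
  map_smul' a ξ := by
    ext y
    by_cases hy : y ∈ e.target <;> simp [hy, smul_comm _ a]

theorem weightedComp_apply {X Y 𝕜 E : Type*} [RCLike 𝕜] [NormedAddCommGroup E]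
    [NormedSpace 𝕜 E] (e : PartialEquiv X Y) (Φ : X → ℝ) (ξ : X → E) :
    weightedComp 𝕜 E e Φ ξ = e.target.indicator fun y =>
      ((Φ (e.symm y) ^ (-(1 / 2) : ℝ) : ℝ) : 𝕜) • ξ (e.symm y) :=
  rfl

theorem enorm_rpow_neg_half_smul {𝕜 E : Type*} [RCLike 𝕜] [NormedAddCommGroup E]
    [NormedSpace 𝕜 E] {t : ℝ} (ht : 0 < t) (z : E) :
    ENNReal.ofReal t * ‖((t ^ (-(1 / 2) : ℝ) : ℝ) : 𝕜) • z‖ₑ ^ (2 : ℝ) = ‖z‖ₑ ^ (2 : ℝ) := by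
  have h_enorm : ‖((t ^ (-(1 / 2) : ℝ) : ℝ) : 𝕜)‖ₑ = ENNReal.ofReal (t ^ (-(1 / 2) : ℝ)) := by
    rw [← ofReal_norm, RCLike.norm_ofReal, abs_of_nonneg (by positivity)]
  have h_mul : t * (t ^ (-(1 / 2) : ℝ)) ^ (2 : ℝ) = 1 := by
    rw [← Real.rpow_mul ht.le]
    norm_num [Real.rpow_neg_one, ht.ne']
  rw [enorm_smul, ENNReal.mul_rpow_of_nonneg _ _ two_pos.le, ← mul_assoc, h_enorm,
    ENNReal.ofReal_rpow_of_nonneg (by positivity) two_pos.le, ← ENNReal.ofReal_mul ht.le, h_mul,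
    ENNReal.ofReal_one, one_mul]

theorem inner_inv_rpow_neg_half_smul {𝕜 E : Type*} [RCLike 𝕜] [NormedAddCommGroup E]
    [InnerProductSpace 𝕜 E] {t : ℝ} (ht : 0 < t) (x y : E) :
    inner 𝕜 (((t⁻¹ ^ (-(1 / 2) : ℝ) : ℝ) : 𝕜) • x) y =
      t • inner 𝕜 x (((t ^ (-(1 / 2) : ℝ) : ℝ) : 𝕜) • y) := by
  have h_rpow : t⁻¹ ^ (-(1 / 2) : ℝ) = t * t ^ (-(1 / 2) : ℝ) := by
    rw [Real.inv_rpow ht.le, ← Real.rpow_neg ht.le, ← Real.rpow_one_add' ht.le (by norm_num)]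
    norm_num
  rw [inner_smul_left, inner_smul_right, RCLike.conj_ofReal, h_rpow, RCLike.real_smul_eq_coe_mul,
    RCLike.ofReal_mul, mul_assoc]

namespace IsNonsingular

variable {X Y Z : Type*} [MeasurableSpace X] [MeasurableSpace Y] [MeasurableSpace Z]
  {μ : Measure X} {ν : Measure Y} {ρ : Measure Z} {e e₁ : PartialEquiv X Y} {Φ Φ₁ : X → ℝ}
  {e' : PartialEquiv Y Z} {Ψ : Y → ℝ}

section Normed

variable {𝕜 E : Type*} [RCLike 𝕜] [NormedAddCommGroup E] [NormedSpace 𝕜 E]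

theorem weightedComp_congr (h : IsNonsingular μ ν e Φ) {f g : X → E} (hfg : f =ᵐ[μ] g) :
    weightedComp 𝕜 E e Φ f =ᵐ[ν] weightedComp 𝕜 E e Φ g := by
  have h_comp : ∀ᵐ y ∂ν.restrict e.target, f (e.symm y) = g (e.symm y) :=
    h.ae_comp_symm (ae_restrict_of_ae hfg)
  filter_upwards [(ae_restrict_iff' h.measurableSet_target).1 h_comp] with y hy
  by_cases hyt : y ∈ e.target
  · simp only [weightedComp_apply, Set.indicator_of_mem hyt, hy hyt]
  · simp only [weightedComp_apply, Set.indicator_of_notMem hyt]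

theorem aestronglyMeasurable_rpow_smul (h : IsNonsingular μ ν e Φ) {ξ : X → E}
    (hξ : AEStronglyMeasurable ξ μ) (s : ℝ) :
    AEStronglyMeasurable (fun x => ((Φ x ^ s : ℝ) : 𝕜) • ξ x) (μ.restrict e.source) :=
  (RCLike.continuous_ofReal.comp_aestronglyMeasurable
    (h.aemeasurable_deriv.pow_const s).aestronglyMeasurable).smul hξ.restrict

theorem aestronglyMeasurable_weightedComp (h : IsNonsingular μ ν e Φ) {ξ : X → E}
    (hξ : AEStronglyMeasurable ξ μ) : AEStronglyMeasurable (weightedComp 𝕜 E e Φ ξ) ν :=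
  (aestronglyMeasurable_indicator_iff h.measurableSet_target).2
    (h.aestronglyMeasurable_comp_symm (h.aestronglyMeasurable_rpow_smul hξ _))

theorem eLpNorm_weightedComp (h : IsNonsingular μ ν e Φ) {ξ : X → E}
    (hξ : AEStronglyMeasurable ξ μ) :
    eLpNorm (weightedComp 𝕜 E e Φ ξ) 2 ν = eLpNorm ξ 2 (μ.restrict e.source) := by
  have h_weight := h.aestronglyMeasurable_rpow_smul (𝕜 := 𝕜) hξ (-(1 / 2))
  rw [weightedComp_apply, eLpNorm_indicator_eq_eLpNorm_restrict h.measurableSet_target,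
    eLpNorm_eq_lintegral_rpow_enorm_toReal two_ne_zero ENNReal.ofNat_ne_top,
    eLpNorm_eq_lintegral_rpow_enorm_toReal two_ne_zero ENNReal.ofNat_ne_top, ENNReal.toReal_ofNat]
  congr 1
  refine (h.lintegral_comp_symm (h_weight.enorm.pow_const _)).trans ?_
  exact lintegral_congr_ae (h.deriv_pos.mono fun x hx => enorm_rpow_neg_half_smul hx _)

theorem eLpNorm_weightedComp_le (h : IsNonsingular μ ν e Φ) {ξ : X → E}
    (hξ : AEStronglyMeasurable ξ μ) : eLpNorm (weightedComp 𝕜 E e Φ ξ) 2 ν ≤ eLpNorm ξ 2 μ :=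
  (h.eLpNorm_weightedComp hξ).trans_le (eLpNorm_restrict_le _ _ _ _)

theorem memLp_weightedComp (h : IsNonsingular μ ν e Φ) {ξ : X → E} (hξ : MemLp ξ 2 μ) :
    MemLp (weightedComp 𝕜 E e Φ ξ) 2 ν :=
  ⟨h.aestronglyMeasurable_weightedComp hξ.1, (h.eLpNorm_weightedComp_le hξ.1).trans_lt hξ.2⟩

/-- The bounded operator on `L²` given by weighted composition along a nonsingular partial
bijection. -/
noncomputable def operator (𝕜 E : Type*) [RCLike 𝕜] [NormedAddCommGroup E] [NormedSpace 𝕜 E]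
    (h : IsNonsingular μ ν e Φ) : Lp E 2 μ →L[𝕜] Lp E 2 ν :=
  LinearMap.mkContinuous
    { toFun ξ := (h.memLp_weightedComp (𝕜 := 𝕜) (Lp.memLp ξ)).toLp
      map_add' ξ η := by
        rw [← MemLp.toLp_add, MemLp.toLp_eq_toLp_iff, ← map_add]
        exact h.weightedComp_congr (Lp.coeFn_add ξ η)
      map_smul' a ξ := by
        rw [RingHom.id_apply, ← MemLp.toLp_const_smul, MemLp.toLp_eq_toLp_iff, ← map_smul]
        exact h.weightedComp_congr (Lp.coeFn_smul a ξ) }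
    1 fun ξ => by
      rw [one_mul, LinearMap.coe_mk, AddHom.coe_mk, Lp.norm_toLp, Lp.norm_def]
      exact ENNReal.toReal_mono (Lp.eLpNorm_ne_top ξ)
        (h.eLpNorm_weightedComp_le (Lp.aestronglyMeasurable ξ))

theorem coeFn_operator (h : IsNonsingular μ ν e Φ) (ξ : Lp E 2 μ) :
    h.operator 𝕜 E ξ =ᵐ[ν] weightedComp 𝕜 E e Φ ξ :=
  (h.memLp_weightedComp (Lp.memLp ξ)).coeFn_toLp

theorem weightedComp_trans (h : IsNonsingular μ ν e Φ) (h' : IsNonsingular ν ρ e' Ψ) (ξ : X → E) :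
    weightedComp 𝕜 E (e.trans e') (fun x => Φ x * Ψ (e x)) ξ =ᵐ[ρ]
      weightedComp 𝕜 E e' Ψ (weightedComp 𝕜 E e Φ ξ) := by
  have h_pos : ∀ᵐ z ∂ρ, z ∈ (e.trans e').target →
      0 < Φ ((e.trans e').symm z) * Ψ (e ((e.trans e').symm z)) :=
    (ae_restrict_iff' (h.trans h').measurableSet_target).1
      ((h.trans h').ae_comp_symm (h.trans h').deriv_pos)
  have h_pos' : ∀ᵐ z ∂ρ, z ∈ e'.target → 0 < Ψ (e'.symm z) :=
    (ae_restrict_iff' h'.measurableSet_target).1 (h'.ae_comp_symm h'.deriv_pos)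
  filter_upwards [h_pos, h_pos'] with z hz hz'
  by_cases hz_mem : z ∈ e'.target
  · by_cases hz_symm : e'.symm z ∈ e.target
    · specialize hz ⟨hz_mem, hz_symm⟩
      specialize hz' hz_mem
      have h_symm : (e.trans e').symm z = e.symm (e'.symm z) := rfl
      rw [h_symm, e.right_inv hz_symm] at hz
      have hΦ : 0 < Φ (e.symm (e'.symm z)) := pos_of_mul_pos_left hz hz'.le
      have hz_trans : z ∈ (e.trans e').target := ⟨hz_mem, hz_symm⟩
      simp only [weightedComp_apply, Set.indicator_of_mem, hz_mem, hz_symm, hz_trans, h_symm,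
        e.right_inv hz_symm]
      rw [mul_comm, Real.mul_rpow hz'.le hΦ.le, RCLike.ofReal_mul, mul_smul]
    · have hz_trans : z ∉ (e.trans e').target := fun hz => hz_symm hz.2
      simp only [weightedComp_apply, Set.indicator_of_mem hz_mem, Set.indicator_of_notMem hz_symm,
        Set.indicator_of_notMem hz_trans, smul_zero]
  · have hz_trans : z ∉ (e.trans e').target := fun hz => hz_mem hz.1
    simp only [weightedComp_apply, Set.indicator_of_notMem hz_mem,
      Set.indicator_of_notMem hz_trans]

theorem operator_trans (h : IsNonsingular μ ν e Φ) (h' : IsNonsingular ν ρ e' Ψ) :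
    (h.trans h').operator 𝕜 E = h'.operator 𝕜 E ∘L h.operator 𝕜 E := by
  ext ξ
  exact ((h.trans h').coeFn_operator ξ).trans ((h.weightedComp_trans h' ξ).trans
    ((h'.weightedComp_congr (h.coeFn_operator ξ)).symm.trans
      (h'.coeFn_operator (h.operator 𝕜 E ξ)).symm))

-- Densities agree only on σ-finite pieces of `μ`, but an `L²` function lives on such a piece.
theorem ae_deriv_eq_or_eq_zero (h : IsNonsingular μ ν e Φ) (h₁ : IsNonsingular μ ν e Φ₁)
    (ξ : Lp E 2 μ) : ∀ᵐ x ∂μ.restrict e.source, Φ x = Φ₁ x ∨ ξ x = 0 := by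
  obtain ⟨F, hF, hξF, hσF⟩ := ((Lp.memLp ξ).aefinStronglyMeasurable two_ne_zero
    ENNReal.ofNat_ne_top).exists_set_sigmaFinite
  have h_ofReal : (fun x => ENNReal.ofReal (Φ x)) =ᵐ[(μ.restrict F).restrict e.source]
      fun x => ENNReal.ofReal (Φ₁ x) := by
    have h_le : (μ.restrict F).restrict e.source ≤ μ.restrict e.source :=
      Measure.restrict_mono_measure Measure.restrict_le_self _
    refine (withDensity_eq_iff_of_sigmaFinite
      (h.aemeasurable_deriv.mono_measure h_le).ennreal_ofReal
      (h₁.aemeasurable_deriv.mono_measure h_le).ennreal_ofReal).1 ?_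
    rw [← Measure.restrict_comm hF, ← restrict_withDensity hF, ← restrict_withDensity hF,
      ← h.map_symm, ← h₁.map_symm]
  rw [← Measure.restrict_comm hF, Filter.EventuallyEq, ae_restrict_iff' hF] at h_ofReal
  filter_upwards [h_ofReal, h.deriv_pos, h₁.deriv_pos,
    ae_restrict_of_ae ((ae_restrict_iff' hF.compl).1 hξF)] with x h_eq h_pos h_pos₁ h_zero
  by_cases hxF : x ∈ F
  · exact .inl ((ENNReal.ofReal_eq_ofReal_iff h_pos.le h_pos₁.le).1 (h_eq hxF))
  · exact .inr (h_zero hxF)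

theorem of_eqOnSource (h : IsNonsingular μ ν e Φ) (he : e ≈ e₁) : IsNonsingular μ ν e₁ Φ where
  measurableSet_source := he.source_eq ▸ h.measurableSet_source
  measurableSet_target := he.target_eq ▸ h.measurableSet_target
  measurable_toFun := by
    rw [← he.source_eq, ← Set.domRestrict_eq_domRestrict_iff.2 he.eqOn]
    exact h.measurable_toFun
  measurable_symm := by
    rw [← he.target_eq, ← Set.domRestrict_eq_domRestrict_iff.2 he.symm_eqOn]
    exact h.measurable_symm
  aemeasurable_deriv := he.source_eq ▸ h.aemeasurable_deriv
  deriv_pos := he.source_eq ▸ h.deriv_pos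
  map_symm := by
    rw [← he.source_eq, ← he.target_eq, ← h.map_symm]
    exact (Measure.map_congr
      ((ae_restrict_iff' h.measurableSet_target).2 (ae_of_all _ he.symm_eqOn))).symm

theorem operator_congr (h : IsNonsingular μ ν e Φ) (h₁ : IsNonsingular μ ν e₁ Φ₁) (he : e ≈ e₁) :
    h.operator 𝕜 E = h₁.operator 𝕜 E := by
  ext ξ
  have h_deriv : ∀ᵐ y ∂ν, y ∈ e.target →
      Φ (e.symm y) = Φ₁ (e.symm y) ∨ ξ (e.symm y) = 0 :=
    (ae_restrict_iff' h.measurableSet_target).1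
      (h.ae_comp_symm (h.ae_deriv_eq_or_eq_zero (h₁.of_eqOnSource (Setoid.symm he)) ξ))
  refine (h.coeFn_operator ξ).trans (.trans ?_ (h₁.coeFn_operator ξ).symm)
  filter_upwards [h_deriv] with y hy
  by_cases hy_mem : y ∈ e.target
  · have hy_mem₁ : y ∈ e₁.target := he.target_eq ▸ hy_mem
    rw [weightedComp_apply, weightedComp_apply, Set.indicator_of_mem hy_mem,
      Set.indicator_of_mem hy_mem₁, ← he.symm_eqOn hy_mem]
    rcases hy hy_mem with hΦ | hξ
    · rw [hΦ]
    · rw [hξ, smul_zero, smul_zero]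
  · have hy_mem₁ : y ∉ e₁.target := he.target_eq ▸ hy_mem
    rw [weightedComp_apply, weightedComp_apply, Set.indicator_of_notMem hy_mem,
      Set.indicator_of_notMem hy_mem₁]

theorem coeFn_operator_ofSet {s : Set X} (hs : MeasurableSet s) (ξ : Lp E 2 μ) :
    (ofSet hs : IsNonsingular μ μ _ _).operator 𝕜 E ξ =ᵐ[μ] s.indicator ξ :=
  (coeFn_operator _ ξ).trans (ae_of_all _ fun x => by
    by_cases hx : x ∈ s <;> simp [weightedComp_apply, hx])

theorem operator_symm_comp_operator (h : IsNonsingular μ ν e Φ) :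
    h.symm.operator 𝕜 E ∘L h.operator 𝕜 E =
      (ofSet h.measurableSet_source : IsNonsingular μ μ _ _).operator 𝕜 E := by
  rw [← operator_trans]
  exact operator_congr _ _ e.self_trans_symm

theorem operator_comp_operator_symm (h : IsNonsingular μ ν e Φ) :
    h.operator 𝕜 E ∘L h.symm.operator 𝕜 E =
      (ofSet h.measurableSet_target : IsNonsingular ν ν _ _).operator 𝕜 E := by
  rw [← operator_trans]
  exact operator_congr _ _ e.symm_trans_self

theorem operator_comp_operator_symm_comp_operator (h : IsNonsingular μ ν e Φ) :
    h.operator 𝕜 E ∘L h.symm.operator 𝕜 E ∘L h.operator 𝕜 E = h.operator 𝕜 E := by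
  rw [operator_symm_comp_operator, ← operator_trans]
  exact operator_congr _ _ ⟨by simp [PartialEquiv.trans_source], fun _ _ => rfl⟩

theorem operator_ofSet_eq_sum {ι : Type*} [Fintype ι] {s : Set X} {t : ι → Set X}
    (hs : MeasurableSet s) (ht : ∀ i, MeasurableSet (t i))
    (h_disj : Pairwise fun i j => AEDisjoint μ (t i) (t j)) (h_union : s =ᵐ[μ] ⋃ i, t i) :
    (ofSet hs : IsNonsingular μ μ _ _).operator 𝕜 E =
      ∑ i, (ofSet (ht i) : IsNonsingular μ μ _ _).operator 𝕜 E := by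
  ext ξ
  rw [sum_apply]
  have h_single : ∀ᵐ x ∂μ, ∀ i j, i ≠ j → x ∉ t i ∩ t j :=
    ae_all_iff.2 fun i => ae_all_iff.2 fun j =>
      Filter.eventually_imp_distrib_left.2 fun hij => measure_eq_zero_iff_ae_notMem.1 (h_disj hij)
  have h_terms : ∀ᵐ x ∂μ, ∀ i, (ofSet (ht i) : IsNonsingular μ μ _ _).operator 𝕜 E ξ x =
      (t i).indicator ξ x := ae_all_iff.2 fun i => coeFn_operator_ofSet (ht i) ξ
  filter_upwards [coeFn_operator_ofSet (𝕜 := 𝕜) hs ξ, Lp.coeFn_finsetSum Finset.univ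
    fun i => (ofSet (ht i) : IsNonsingular μ μ _ _).operator 𝕜 E ξ, h_terms, h_single,
    h_union.mem_iff] with x hx_left hx_sum hx_terms hx_single hx_union
  rw [hx_left, hx_sum, Finset.sum_apply]
  simp only [hx_terms]
  by_cases hx : ∃ i, x ∈ t i
  · obtain ⟨i, hi⟩ := hx
    rw [Set.indicator_of_mem (hx_union.2 (Set.mem_iUnion.2 ⟨i, hi⟩)),
      Finset.sum_eq_single_of_mem i (Finset.mem_univ i) fun j _ hj =>
        Set.indicator_of_notMem (fun hxj => hx_single j i hj ⟨hxj, hi⟩) _,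
      Set.indicator_of_mem hi]
  · rw [Set.indicator_of_notMem fun hxs => hx (Set.mem_iUnion.1 (hx_union.1 hxs))]
    exact (Finset.sum_eq_zero fun i _ =>
      Set.indicator_of_notMem (fun hxi => hx ⟨i, hxi⟩) _).symm

end Normed

section Inner

variable {𝕜 E : Type*} [RCLike 𝕜] [NormedAddCommGroup E] [InnerProductSpace 𝕜 E]
  [CompleteSpace E]

theorem adjoint_operator (h : IsNonsingular μ ν e Φ) :
    ContinuousLinearMap.adjoint (h.operator 𝕜 E) = h.symm.operator 𝕜 E := by
  refine ((ContinuousLinearMap.eq_adjoint_iff _ _).2 fun η ξ => ?_).symm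
  let w (t : ℝ) : 𝕜 := ((t ^ (-(1 / 2) : ℝ) : ℝ) : 𝕜)
  have h_meas : AEStronglyMeasurable (fun x => inner 𝕜 (η (e x)) (w (Φ x) • ξ x))
      (μ.restrict e.source) :=
    (h.symm.aestronglyMeasurable_comp_symm (Lp.aestronglyMeasurable η).restrict).inner
      (h.aestronglyMeasurable_rpow_smul (𝕜 := 𝕜) (Lp.aestronglyMeasurable ξ) _)
  rw [L2.inner_def, L2.inner_def]
  calc ∫ x, inner 𝕜 (h.symm.operator 𝕜 E η x) (ξ x) ∂μ
      = ∫ x in e.source, Φ x • inner 𝕜 (η (e x)) (w (Φ x) • ξ x) ∂μ := by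
        rw [← integral_indicator h.measurableSet_source]
        have h_pos := (ae_restrict_iff' h.measurableSet_source).1 h.deriv_pos
        refine integral_congr_ae ?_
        filter_upwards [h.symm.coeFn_operator (𝕜 := 𝕜) η, h_pos] with x hx hx_pos
        simp only [hx, weightedComp_apply]
        by_cases hx_mem : x ∈ e.source
        · simpa [hx_mem, w] using
            inner_inv_rpow_neg_half_smul (𝕜 := 𝕜) (hx_pos hx_mem) (η (e x)) (ξ x)
        · simp [hx_mem]
    _ = ∫ y in e.target, inner 𝕜 (η (e (e.symm y))) (w (Φ (e.symm y)) • ξ (e.symm y)) ∂ν :=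
        (h.integral_comp_symm h_meas).symm
    _ = ∫ y, inner 𝕜 (η y) (h.operator 𝕜 E ξ y) ∂ν := by
        rw [← integral_indicator h.measurableSet_target]
        refine integral_congr_ae ?_
        filter_upwards [h.coeFn_operator (𝕜 := 𝕜) ξ] with y hy
        simp only [hy, weightedComp_apply]
        by_cases hy_mem : y ∈ e.target <;> simp [hy_mem, e.right_inv, w]

theorem adjoint_operator_comp_eq_zero {e₂ : PartialEquiv Z Y} {Φ₂ : Z → ℝ}
    (h : IsNonsingular μ ν e Φ) (h₂ : IsNonsingular ρ ν e₂ Φ₂)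
    (h_disj : AEDisjoint ν e.target e₂.target) :
    ContinuousLinearMap.adjoint (h.operator 𝕜 E) ∘L h₂.operator 𝕜 E = 0 := by
  ext1 ξ
  refine ext_inner_left 𝕜 fun η => ?_
  rw [ContinuousLinearMap.comp_apply, ContinuousLinearMap.adjoint_inner_right, L2.inner_def,
    zero_apply, inner_zero_right]
  refine integral_eq_zero_of_ae ?_
  filter_upwards [h.coeFn_operator (𝕜 := 𝕜) η, h₂.coeFn_operator (𝕜 := 𝕜) ξ,
    measure_eq_zero_iff_ae_notMem.1 h_disj] with y hy hy₂ hy_disj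
  by_cases hy_mem : y ∈ e.target
  · rw [hy₂, weightedComp_apply, Set.indicator_of_notMem fun hy_mem₂ => hy_disj ⟨hy_mem, hy_mem₂⟩,
      inner_zero_right, Pi.zero_apply]
  · rw [hy, weightedComp_apply, Set.indicator_of_notMem hy_mem, inner_zero_left, Pi.zero_apply]

end Inner
end IsNonsingular
end WeightedComposition

namespace HigherRankGraph

variable {k : ℕ} {Λ : Type u} [Category.{v} Λ]

/-! ### Factorization of paths into edges -/

section Paths

theorem sum_basisVec (i : Fin k) : ∑ j, basisVec i j = 1 := by
  simp [basisVec]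

theorem basisVec_add_sub_cancel {n : Fin k → ℕ} {i : Fin k} (h : n i ≠ 0) :
    basisVec i + (n - basisVec i) = n := by
  refine add_tsub_cancel_of_le fun j => ?_
  rcases eq_or_ne j i with rfl | hj
  · simpa [basisVec, Nat.one_le_iff_ne_zero] using h
  · simp [basisVec, hj]

theorem sum_sub_basisVec_lt {n : Fin k → ℕ} {i : Fin k} (h : n i ≠ 0) :
    ∑ j, (n - basisVec i) j < ∑ j, n j := by
  conv_rhs => rw [← basisVec_add_sub_cancel h]
  simp only [Pi.add_apply, Finset.sum_add_distrib, sum_basisVec]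
  omega

variable (G : HigherRankGraph k Λ)

/-- The total degree of a path: the number of edges in any of its factorizations into edges. -/
def length {a b : Λ} (l : a ⟶ b) : ℕ := ∑ i, G.deg (Arrow.mk l) i

theorem length_comp {a b c : Λ} (g : a ⟶ b) (f : b ⟶ c) :
    G.length (g ≫ f) = G.length f + G.length g := by
  simp only [length, G.deg_comp, Pi.add_apply, Finset.sum_add_distrib]

theorem length_edge {a b : Λ} {f : a ⟶ b} {i : Fin k} (hf : G.deg (Arrow.mk f) = basisVec i) :
    G.length f = 1 := by
  rw [length, hf, sum_basisVec]

theorem exists_comp_eq {a c : Λ} {l : a ⟶ c} {m n : Fin k → ℕ} (h : G.deg (Arrow.mk l) = m + n) :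
    ∃ (b : Λ) (g : a ⟶ b) (f : b ⟶ c),
      g ≫ f = l ∧ G.deg (Arrow.mk f) = m ∧ G.deg (Arrow.mk g) = n := by
  obtain ⟨⟨b, g, f⟩, hp, -⟩ := G.factorization l m n h
  exact ⟨b, g, f, hp⟩

theorem factorization_unique {a b b' c : Λ} {g : a ⟶ b} {f : b ⟶ c} {g' : a ⟶ b'} {f' : b' ⟶ c}
    (h : g ≫ f = g' ≫ f') (hf : G.deg (Arrow.mk f) = G.deg (Arrow.mk f')) :
    (⟨b, g, f⟩ : Σ b, (a ⟶ b) × (b ⟶ c)) = ⟨b', g', f'⟩ := by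
  have hg : G.deg (Arrow.mk g) = G.deg (Arrow.mk g') := by
    have h_deg := congrArg (fun l => G.deg (Arrow.mk l)) h
    simp only [G.deg_comp, hf] at h_deg
    exact add_left_cancel h_deg
  exact (G.factorization (g ≫ f) _ _ (G.deg_comp g f)).unique ⟨rfl, rfl, rfl⟩
    ⟨h.symm, hf.symm, hg.symm⟩

theorem eq_id_of_deg_eq_zero {a b : Λ} {l : a ⟶ b} (h : G.deg (Arrow.mk l) = 0) :
    (⟨a, l⟩ : Σ a, a ⟶ b) = ⟨b, 𝟙 b⟩ := by
  have h_unique := G.factorization_unique (g := 𝟙 a) (f := l) (g' := l) (f' := 𝟙 b) (by simp)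
    (by rw [h, G.deg_id])
  cases h_unique
  rfl

/-- A factorization of the path `l` as a path followed by an edge, its last edge. -/
structure LastEdge {a c : Λ} (l : a ⟶ c) where
  color : Fin k
  mid : Λ
  init : a ⟶ mid
  last : mid ⟶ c
  deg_last : G.deg (Arrow.mk last) = basisVec color
  init_comp_last : init ≫ last = l

variable {G}

theorem nonempty_lastEdge {a c : Λ} {l : a ⟶ c} {i : Fin k} (h : G.deg (Arrow.mk l) i ≠ 0) :
    Nonempty (G.LastEdge l) := by
  obtain ⟨b, g, f, hgf, hf, -⟩ := G.exists_comp_eq (basisVec_add_sub_cancel h).symm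
  exact ⟨⟨i, b, g, f, hf, hgf⟩⟩

theorem LastEdge.length_init {a c : Λ} {l : a ⟶ c} (e : G.LastEdge l) :
    1 + G.length e.init = G.length l := by
  have h_length := congrArg G.length e.init_comp_last
  rwa [G.length_comp, G.length_edge e.deg_last] at h_length

theorem path_induction {motive : ∀ {a b : Λ}, (a ⟶ b) → Prop} (id : ∀ a, motive (𝟙 a))
    (comp_edge : ∀ {a b c : Λ} (m : a ⟶ b) (f : b ⟶ c) (i : Fin k),
      G.deg (Arrow.mk f) = basisVec i → motive m → motive (m ≫ f))
    {a b : Λ} (l : a ⟶ b) : motive l := by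
  by_cases h : G.deg (Arrow.mk l) = 0
  · cases G.eq_id_of_deg_eq_zero h
    exact id _
  · obtain ⟨i, hi⟩ := Function.ne_iff.1 h
    obtain ⟨e⟩ := nonempty_lastEdge hi
    exact e.init_comp_last ▸ comp_edge e.init e.last e.color e.deg_last
      (path_induction id comp_edge e.init)
termination_by G.length l
decreasing_by exact e.length_init ▸ Nat.lt_add_of_pos_left Nat.one_pos

theorem exists_square {a b b' c : Λ} {i j : Fin k} (hij : i ≠ j) {m : a ⟶ b} {f : b ⟶ c}
    {m' : a ⟶ b'} {f' : b' ⟶ c} (hf : G.deg (Arrow.mk f) = basisVec i)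
    (hf' : G.deg (Arrow.mk f') = basisVec j) (h : m ≫ f = m' ≫ f') :
    ∃ (d : Λ) (r : a ⟶ d) (g : d ⟶ b) (g' : d ⟶ b'),
      G.deg (Arrow.mk g) = basisVec j ∧ G.deg (Arrow.mk g') = basisVec i ∧
        r ≫ g = m ∧ r ≫ g' = m' ∧ g ≫ f = g' ≫ f' := by
  have h_deg := congrArg (fun l => G.deg (Arrow.mk l)) h
  simp only [G.deg_comp, hf, hf'] at h_deg
  have hmj : G.deg (Arrow.mk m) j ≠ 0 := by
    have h_deg_j := congrFun h_deg j
    simp only [basisVec, Pi.add_apply, Pi.single_eq_same, Pi.single_eq_of_ne hij.symm] at h_deg_j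
    omega
  obtain ⟨d, r, g, rfl, hg, -⟩ := G.exists_comp_eq (basisVec_add_sub_cancel hmj).symm
  obtain ⟨b'', g', f'', hgf, hf'', hg'⟩ : ∃ (b'' : Λ) (g' : d ⟶ b'') (f'' : b'' ⟶ c),
      g' ≫ f'' = g ≫ f ∧ G.deg (Arrow.mk f'') = basisVec j ∧ G.deg (Arrow.mk g') = basisVec i :=
    G.exists_comp_eq (by rw [G.deg_comp, hf, hg, add_comm])
  have h_unique := G.factorization_unique (g := r ≫ g') (f := f'') (g' := m') (f' := f')
    (by rw [Category.assoc, hgf, ← h, Category.assoc]) (hf''.trans hf'.symm)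
  cases h_unique
  exact ⟨d, r, g, g', hg, hg', rfl, rfl, hgf.symm⟩

end Paths

section PathTo

/-- The paths of degree `n` with range `a`, as a type of morphisms into `a` rather than the set
`G.pathsInto a n` of arrows. -/
structure PathTo (G : HigherRankGraph k Λ) (a : Λ) (n : Fin k → ℕ) where
  source : Λ
  hom : source ⟶ a
  deg_hom : G.deg (Arrow.mk hom) = n

/-- Every vertex receives finitely many paths of each degree. -/
def IsRowFinite (G : HigherRankGraph k Λ) : Prop := ∀ a n, (G.pathsInto a n).Finite

variable {G : HigherRankGraph k Λ} {a : Λ} {m n : Fin k → ℕ}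

theorem IsFinite.isRowFinite (h : G.IsFinite) : G.IsRowFinite :=
  fun _ n => (h n).subset fun _ hf => hf.2

/-- The edge given by a path whose degree is a standard basis vector. -/
def PathTo.edge {i : Fin k} (p : G.PathTo a (basisVec i)) : G.Edge i :=
  ⟨Arrow.mk p.hom, p.deg_hom⟩

/-- `Edge.toPathTo f` is the edge `f` as a path into its range. -/
def Edge.toPathTo {i : Fin k} (f : G.Edge i) : G.PathTo f.1.right (basisVec i) :=
  ⟨f.1.left, f.1.hom, f.2⟩

theorem PathTo.arrow_injective :
    Function.Injective (fun p : G.PathTo a n => Arrow.mk p.hom) := by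
  rintro ⟨b, f, hf⟩ ⟨b', f', hf'⟩ h
  cases h
  rfl

theorem PathTo.range_arrow :
    Set.range (fun p : G.PathTo a n => Arrow.mk p.hom) = G.pathsInto a n := by
  ext ⟨b, c, f⟩
  constructor
  · rintro ⟨p, hp⟩
    exact hp ▸ ⟨rfl, p.deg_hom⟩
  · rintro ⟨rfl, hf⟩
    exact ⟨⟨b, f, hf⟩, rfl⟩

theorem IsRowFinite.finite_pathTo (h : G.IsRowFinite) (a : Λ) (n : Fin k → ℕ) :
    Finite (G.PathTo a n) :=
  (Set.finite_range_iff PathTo.arrow_injective).1 (PathTo.range_arrow (G := G) ▸ h a n)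

theorem finsum_mem_pathsInto [Fintype (G.PathTo a n)] {M : Type*} [AddCommMonoid M]
    (F : Arrow Λ → M) : ∑ᶠ f ∈ G.pathsInto a n, F f = ∑ p : G.PathTo a n, F (Arrow.mk p.hom) := by
  rw [← PathTo.range_arrow, finsum_mem_range PathTo.arrow_injective, finsum_eq_sum_of_fintype]

/-- The composite of a path into `a` with a path into its source. -/
def PathTo.comp (p : Σ p : G.PathTo a m, G.PathTo p.source n) : G.PathTo a (m + n) :=
  ⟨p.2.source, p.2.hom ≫ p.1.hom, by rw [G.deg_comp, p.1.deg_hom, p.2.deg_hom]⟩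

theorem PathTo.comp_bijective :
    Function.Bijective
      (PathTo.comp : (Σ p : G.PathTo a m, G.PathTo p.source n) → G.PathTo a (m + n)) := by
  constructor
  · rintro ⟨⟨b, f, hf⟩, ⟨c, g, hg⟩⟩ ⟨⟨b', f', hf'⟩, ⟨c', g', hg'⟩⟩ h
    simp only [PathTo.comp, PathTo.mk.injEq] at h
    obtain ⟨rfl, h_comp⟩ := h
    have h_unique := G.factorization_unique (eq_of_heq h_comp) (hf.trans hf'.symm)
    cases h_unique
    rfl
  · rintro ⟨c, l, hl⟩
    obtain ⟨b, g, f, rfl, hf, hg⟩ := G.exists_comp_eq hl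
    exact ⟨⟨⟨b, f, hf⟩, ⟨c, g, hg⟩⟩, rfl⟩

theorem sum_pathTo_add [∀ a n, Fintype (G.PathTo a n)] {M : Type*} [AddCommMonoid M]
    (F : G.PathTo a (m + n) → M) :
    ∑ l, F l = ∑ p : G.PathTo a m, ∑ q : G.PathTo p.source n, F (PathTo.comp ⟨p, q⟩) := by
  rw [← PathTo.comp_bijective.sum_comp, Fintype.sum_sigma]

end PathTo

section PathProd

variable {G : HigherRankGraph k Λ} {M : Type*}

/-- Elements indexed by the edges commute on squares if both factorizations `α ≫ lam = β ≫ ν` of a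
path into two edges of given colours give the same product. -/
def CommutesOnSquares [Mul M] (T : ∀ i, G.Edge i → M) : Prop :=
  ∀ (i j : Fin k) {a b b' d : Λ} (lam : b ⟶ d) (α : a ⟶ b) (ν : b' ⟶ d) (β : a ⟶ b')
    (hlam : Arrow.mk lam ∈ G.pathsOfDeg (basisVec i)) (hα : Arrow.mk α ∈ G.pathsOfDeg (basisVec j))
    (hν : Arrow.mk ν ∈ G.pathsOfDeg (basisVec j)) (hβ : Arrow.mk β ∈ G.pathsOfDeg (basisVec i)),
    α ≫ lam = β ≫ ν → T i ⟨_, hlam⟩ * T j ⟨_, hα⟩ = T j ⟨_, hν⟩ * T i ⟨_, hβ⟩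

open Classical in
/-- The product of the elements `T` along some factorization of a path into edges, multiplied on
the right by the element `x` at the source. If `T` commutes on squares, then it does not depend on
the factorization. -/
noncomputable def pathProd [Mul M] (T : ∀ i, G.Edge i → M) (x : Λ → M) {a c : Λ} (l : a ⟶ c) : M :=
  if h : Nonempty (G.LastEdge l) then
    T h.some.color ⟨Arrow.mk h.some.last, h.some.deg_last⟩ * pathProd T x h.some.init
  else x a
termination_by G.length l
decreasing_by have h_length := h.some.length_init; omega

theorem pathProd_id [Mul M] (T : ∀ i, G.Edge i → M) (x : Λ → M) (a : Λ) :
    pathProd T x (𝟙 a) = x a := by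
  rw [pathProd, dif_neg]
  rintro ⟨e⟩
  have h_length : 1 + G.length e.init = 0 := by
    rw [e.length_init, length, G.deg_id]
    exact Finset.sum_const_zero
  omega

theorem CommutesOnSquares.pathProd_comp_edge [Semigroup M] {T : ∀ i, G.Edge i → M}
    (hT : CommutesOnSquares T) (x : Λ → M) {a b c : Λ} (m : a ⟶ b) {f : b ⟶ c} {i : Fin k}
    (hf : G.deg (Arrow.mk f) = basisVec i) :
    pathProd T x (m ≫ f) = T i ⟨Arrow.mk f, hf⟩ * pathProd T x m := by
  have h_nonempty : Nonempty (G.LastEdge (m ≫ f)) := ⟨⟨i, b, m, f, hf, rfl⟩⟩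
  rw [pathProd, dif_pos h_nonempty]
  suffices h : ∀ e : G.LastEdge (m ≫ f), T e.color ⟨Arrow.mk e.last, e.deg_last⟩ *
      pathProd T x e.init = T i ⟨Arrow.mk f, hf⟩ * pathProd T x m from h _
  rintro ⟨j, b', m', f', hf', h_comp⟩
  change T j ⟨Arrow.mk f', hf'⟩ * pathProd T x m' = T i ⟨Arrow.mk f, hf⟩ * pathProd T x m
  rcases eq_or_ne i j with rfl | hij
  · have h_unique := G.factorization_unique h_comp (hf'.trans hf.symm)
    cases h_unique
    rfl
  · obtain ⟨d, r, g, g', hg, hg', hm, rfl, h_square⟩ := exists_square hij hf hf' h_comp.symm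
    rw [← hm, hT.pathProd_comp_edge x r hg, hT.pathProd_comp_edge x r hg', ← mul_assoc, ← mul_assoc,
      hT i j f g f' g' hf hg hf' hg' h_square]
termination_by G.length m
decreasing_by all_goals
  rw [← hm, G.length_comp, G.length_edge hg]
  omega

end PathProd

/-! ### Edge families -/

section EdgeFamily

variable {G : HigherRankGraph k Λ}
  [∀ a n, Fintype (G.PathTo a n)] {A : Type*}

/-- Elements indexed by the edges that satisfy those Cuntz–Krieger relations that can be written in
terms of edges alone. They are the restrictions of Cuntz–Krieger families to the edges. -/
structure IsEdgeCKFamily [NonUnitalSemiring A] [StarRing A] (S : ∀ i, G.Edge i → A) : Prop where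
  partialIsometry : ∀ i f, S i f * star (S i f) * S i f = S i f
  star_mul_self : ∀ i j (f : G.Edge i),
    star (S i f) * S i f = ∑ g : G.PathTo f.1.left (basisVec j), S j g.edge * star (S j g.edge)
  star_mul_of_ne : ∀ i f g, f ≠ g → star (S i f) * S i g = 0
  commutesOnSquares : CommutesOnSquares S

/-- The projection at the vertex `a`, as the sum of the range projections of the edges of colour `i`
with range `a`. -/
def vertexProj [NonUnitalSemiring A] [StarRing A] (S : ∀ i, G.Edge i → A) (i : Fin k) (a : Λ) : A :=
  ∑ g : G.PathTo a (basisVec i), S i g.edge * star (S i g.edge)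

/-- The extension of an edge family to all paths. The colour `i₀` only serves to express the vertex
projections. -/
noncomputable def pathFamily [NonUnitalSemiring A] [StarRing A] (S : ∀ i, G.Edge i → A)
    (i₀ : Fin k) {a b : Λ} (l : a ⟶ b) : A :=
  pathProd S (vertexProj S i₀) l

theorem pathFamily_id [NonUnitalSemiring A] [StarRing A] (S : ∀ i, G.Edge i → A) (i₀ : Fin k)
    (a : Λ) : pathFamily S i₀ (𝟙 a) = vertexProj S i₀ a :=
  pathProd_id S _ a

theorem isSelfAdjoint_vertexProj [NonUnitalSemiring A] [StarRing A] (S : ∀ i, G.Edge i → A)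
    (i : Fin k) (a : Λ) : IsSelfAdjoint (vertexProj S i a) := by
  simp only [IsSelfAdjoint, vertexProj, star_sum, star_mul, star_star]

namespace IsEdgeCKFamily

variable [NonUnitalSemiring A] [StarRing A] {S : ∀ i, G.Edge i → A} (hS : IsEdgeCKFamily S)
include hS

theorem pathFamily_comp_edge (i₀ : Fin k) {a b c : Λ} (m : a ⟶ b) {f : b ⟶ c} {i : Fin k}
    (hf : G.deg (Arrow.mk f) = basisVec i) :
    pathFamily S i₀ (m ≫ f) = S i ⟨Arrow.mk f, hf⟩ * pathFamily S i₀ m :=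
  hS.commutesOnSquares.pathProd_comp_edge _ m hf

theorem pathFamily_edge (i₀ : Fin k) {i : Fin k} (f : G.Edge i) :
    pathFamily S i₀ f.1.hom = S i f := by
  have h_comp := hS.pathFamily_comp_edge i₀ (𝟙 f.1.left) (f := f.1.hom) f.2
  rw [Category.id_comp, pathFamily_id] at h_comp
  rw [h_comp, vertexProj, ← hS.star_mul_self i i₀ f, ← mul_assoc]
  exact hS.partialIsometry i f

theorem sum_pathFamily_basisVec_add (i₀ i : Fin k) (n : Fin k → ℕ) (a : Λ) :
    ∑ l : G.PathTo a (basisVec i + n), pathFamily S i₀ l.hom * star (pathFamily S i₀ l.hom) =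
      ∑ f : G.PathTo a (basisVec i), S i f.edge *
        (∑ m : G.PathTo f.source n, pathFamily S i₀ m.hom * star (pathFamily S i₀ m.hom)) *
          star (S i f.edge) := by
  rw [sum_pathTo_add]
  refine Finset.sum_congr rfl fun f _ => ?_
  rw [Finset.mul_sum, Finset.sum_mul]
  refine Finset.sum_congr rfl fun m _ => ?_
  have h_comp := hS.pathFamily_comp_edge i₀ m.hom f.deg_hom
  simp only [PathTo.comp, h_comp, star_mul, mul_assoc, PathTo.edge]

theorem mul_vertexProj_mul_star (i₀ i : Fin k) (f : G.Edge i) :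
    S i f * vertexProj S i₀ f.1.left * star (S i f) = S i f * star (S i f) := by
  rw [vertexProj, ← hS.star_mul_self i i₀ f, ← mul_assoc, hS.partialIsometry]

theorem sum_pathFamily_basisVec (i₀ i : Fin k) (a : Λ) :
    ∑ l : G.PathTo a (basisVec i), pathFamily S i₀ l.hom * star (pathFamily S i₀ l.hom) =
      vertexProj S i a :=
  Finset.sum_congr rfl fun l _ => by rw [← hS.pathFamily_edge i₀ l.edge]; rfl

theorem vertexProj_eq_sum (i₀ i j : Fin k) (a : Λ) :
    vertexProj S i a = ∑ l : G.PathTo a (basisVec i + basisVec j),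
      pathFamily S i₀ l.hom * star (pathFamily S i₀ l.hom) := by
  rw [hS.sum_pathFamily_basisVec_add]
  refine Finset.sum_congr rfl fun f _ => ?_
  rw [hS.sum_pathFamily_basisVec i₀ j]
  exact (hS.mul_vertexProj_mul_star j i f.edge).symm

theorem vertexProj_eq (i j : Fin k) (a : Λ) : vertexProj S i a = vertexProj S j a := by
  rw [hS.vertexProj_eq_sum i i j, hS.vertexProj_eq_sum i j i, add_comm (basisVec j)]

theorem vertexProj_mul_edge (i₀ : Fin k) {i : Fin k} (f : G.Edge i) :
    vertexProj S i₀ f.1.right * S i f = S i f := by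
  rw [hS.vertexProj_eq i₀ i, vertexProj, Finset.sum_mul,
    Fintype.sum_eq_single (Edge.toPathTo f) fun g hg => ?_]
  · exact hS.partialIsometry i f
  · have hgf : g.edge ≠ f := fun h => hg (PathTo.arrow_injective (congrArg Subtype.val h))
    rw [mul_assoc, hS.star_mul_of_ne i _ _ hgf, mul_zero]

theorem vertexProj_mul_edge_of_ne (i₀ : Fin k) {i : Fin k} (f : G.Edge i) {a : Λ}
    (ha : a ≠ f.1.right) : vertexProj S i₀ a * S i f = 0 := by
  rw [hS.vertexProj_eq i₀ i, vertexProj, Finset.sum_mul]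
  refine Finset.sum_eq_zero fun g _ => ?_
  have hgf : g.edge ≠ f := fun h => ha (congrArg (fun f : G.Edge i => f.1.right) h)
  rw [mul_assoc, hS.star_mul_of_ne i _ _ hgf, mul_zero]

theorem isStarProjection_vertexProj (i₀ : Fin k) (a : Λ) :
    IsStarProjection (vertexProj S i₀ a) where
  isIdempotentElem := by
    change vertexProj S i₀ a * ∑ g : G.PathTo a (basisVec i₀), S i₀ g.edge * star (S i₀ g.edge) = _
    rw [Finset.mul_sum]
    refine Finset.sum_congr rfl fun g _ => ?_
    rw [← mul_assoc]
    exact congrArg (· * _) (hS.vertexProj_mul_edge i₀ g.edge)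
  isSelfAdjoint := isSelfAdjoint_vertexProj S i₀ a

theorem vertexProj_mul_vertexProj_of_ne (i₀ : Fin k) {a b : Λ} (hab : a ≠ b) :
    vertexProj S i₀ a * vertexProj S i₀ b = 0 := by
  change vertexProj S i₀ a * ∑ g : G.PathTo b (basisVec i₀), S i₀ g.edge * star (S i₀ g.edge) = 0
  rw [Finset.mul_sum]
  refine Finset.sum_eq_zero fun g _ => ?_
  rw [← mul_assoc, hS.vertexProj_mul_edge_of_ne i₀ g.edge hab, zero_mul]

theorem vertexProj_mul_pathFamily (i₀ : Fin k) {a b : Λ} (l : a ⟶ b) :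
    vertexProj S i₀ b * pathFamily S i₀ l = pathFamily S i₀ l := by
  induction l using path_induction (G := G) with
  | id a =>
    rw [pathFamily_id]
    exact (hS.isStarProjection_vertexProj i₀ a).isIdempotentElem
  | comp_edge m f i hf _ =>
    rw [hS.pathFamily_comp_edge i₀ m hf, ← mul_assoc]
    exact congrArg (· * _) (hS.vertexProj_mul_edge i₀ ⟨Arrow.mk f, hf⟩)

theorem pathFamily_comp (i₀ : Fin k) {a b c : Λ} (m : a ⟶ b) (l : b ⟶ c) :
    pathFamily S i₀ (m ≫ l) = pathFamily S i₀ l * pathFamily S i₀ m := by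
  induction l using path_induction (G := G) with
  | id b => rw [Category.comp_id, pathFamily_id, hS.vertexProj_mul_pathFamily]
  | comp_edge l f i hf ih =>
    rw [← Category.assoc, hS.pathFamily_comp_edge i₀ _ hf, hS.pathFamily_comp_edge i₀ _ hf, ih,
      mul_assoc]

theorem star_pathFamily_mul_self (i₀ : Fin k) {a b : Λ} (l : a ⟶ b) :
    star (pathFamily S i₀ l) * pathFamily S i₀ l = vertexProj S i₀ a := by
  induction l using path_induction (G := G) with
  | id a =>
    rw [pathFamily_id, (isSelfAdjoint_vertexProj S i₀ a).star_eq]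
    exact (hS.isStarProjection_vertexProj i₀ a).isIdempotentElem
  | @comp_edge a b c m f i hf ih =>
    have h_star : star (S i ⟨Arrow.mk f, hf⟩) * S i ⟨Arrow.mk f, hf⟩ = vertexProj S i₀ b :=
      hS.star_mul_self i i₀ ⟨Arrow.mk f, hf⟩
    rw [hS.pathFamily_comp_edge i₀ m hf, star_mul, mul_assoc, ← mul_assoc (star (S i _)), h_star,
      hS.vertexProj_mul_pathFamily, ih]

theorem sum_pathFamily_mul_star (i₀ : Fin k) (a : Λ) (n : Fin k → ℕ) :
    ∑ l : G.PathTo a n, pathFamily S i₀ l.hom * star (pathFamily S i₀ l.hom) =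
      vertexProj S i₀ a := by
  by_cases hn : n = 0
  · subst hn
    let p : G.PathTo a 0 := ⟨a, 𝟙 a, G.deg_id a⟩
    have h_unique : ∀ l : G.PathTo a 0, l = p := by
      rintro ⟨b, l, hl⟩
      cases G.eq_id_of_deg_eq_zero hl
      rfl
    rw [Fintype.sum_eq_single p fun l hl => absurd (h_unique l) hl, pathFamily_id,
      (isSelfAdjoint_vertexProj S i₀ a).star_eq]
    exact (hS.isStarProjection_vertexProj i₀ a).isIdempotentElem
  · obtain ⟨i, hi⟩ := Function.ne_iff.1 hn
    have h_split := basisVec_add_sub_cancel hi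
    rw [← h_split, hS.sum_pathFamily_basisVec_add, hS.vertexProj_eq i₀ i]
    refine Finset.sum_congr rfl fun f _ => ?_
    rw [sum_pathFamily_mul_star i₀ f.source (n - basisVec i)]
    exact hS.mul_vertexProj_mul_star i₀ i f.edge
termination_by ∑ j, n j
decreasing_by exact sum_sub_basisVec_lt hi

end IsEdgeCKFamily

theorem IsEdgeCKFamily.isCKFamily {A : Type w} [NonUnitalCStarAlgebra A] {S : ∀ i, G.Edge i → A}
    (hS : IsEdgeCKFamily S) (i₀ : Fin k) : G.IsCKFamily fun f => pathFamily S i₀ f.hom where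
  partialIsometry f := by
    have h_comp := hS.pathFamily_comp i₀ (𝟙 f.left) f.hom
    rw [pathFamily_id, Category.id_comp] at h_comp
    rw [mul_assoc, hS.star_pathFamily_mul_self, ← h_comp]
  ck1_proj a := pathFamily_id S i₀ a ▸ hS.isStarProjection_vertexProj i₀ a
  ck1_orth a b hab := by
    change pathFamily S i₀ (𝟙 a) * pathFamily S i₀ (𝟙 b) = 0
    rw [pathFamily_id, pathFamily_id, hS.vertexProj_mul_vertexProj_of_ne i₀ hab]
  ck2 g f := (hS.pathFamily_comp i₀ g f).symm
  ck3 {a _} f := (hS.star_pathFamily_mul_self i₀ f).trans (pathFamily_id S i₀ a).symm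
  ck4 a n := by
    rw [finsum_mem_pathsInto]
    exact (pathFamily_id S i₀ a).trans (hS.sum_pathFamily_mul_star i₀ a n).symm

end EdgeFamily

/-! ### Representations of `C*(Λ)` -/

section Representation

open scoped CStarAlgebra

variable {G : HigherRankGraph k Λ}

theorem IsCKFamily.mem_of_edge_mem {A : Type*} [NonUnitalCStarAlgebra A] {t : Arrow Λ → A}
    (ht : G.IsCKFamily t) (i₀ : Fin k) {B : NonUnitalStarSubalgebra ℂ A}
    (hB : ∀ i (f : G.Edge i), t f.1 ∈ B) {a b : Λ} (l : a ⟶ b) : t (Arrow.mk l) ∈ B := by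
  induction l using path_induction (G := G) with
  | id a =>
    rw [ht.ck4 a (basisVec i₀)]
    exact finsum_mem_induction (· ∈ B) (zero_mem B) (fun _ _ => add_mem)
      fun f hf => mul_mem (hB i₀ ⟨f, hf.2⟩) (star_mem (hB i₀ ⟨f, hf.2⟩))
  | comp_edge m f i hf ih =>
    rw [← ht.ck2]
    exact mul_mem (hB i ⟨Arrow.mk f, hf⟩) ih

/-- The representation of `C*(Λ)` on `A` given by a Cuntz–Krieger family in `A`. -/
noncomputable def liftCK {A : Type w} [NonUnitalCStarAlgebra A] {t : Arrow Λ → A}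
    (ht : G.IsCKFamily t) : CStarAlg.{u, v, w} G →⋆ₙₐ[ℂ] A where
  toFun x := (x : lp (fun P : CKPair.{u, v, w} G => P.alg) ∞) ⟨A, t, ht⟩
  map_smul' _ _ := rfl
  map_zero' := rfl
  map_add' _ _ := rfl
  map_mul' _ _ := rfl
  map_star' _ := rfl

theorem liftCK_gen {A : Type w} [NonUnitalCStarAlgebra A] {t : Arrow Λ → A}
    (ht : G.IsCKFamily t) (f : Arrow Λ) : liftCK ht (G.gen f) = t f :=
  rfl

theorem isCKFamily_gen [∀ a n, Finite (G.PathTo a n)] : G.IsCKFamily (gen.{u, v, w} G) where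
  partialIsometry f := Subtype.ext <| lp.ext <| funext fun P => P.isCK.partialIsometry f
  ck1_proj a :=
    { isIdempotentElem := Subtype.ext <| lp.ext <| funext fun P =>
        (P.isCK.ck1_proj a).isIdempotentElem.eq
      isSelfAdjoint := Subtype.ext <| lp.ext <| funext fun P =>
        (P.isCK.ck1_proj a).isSelfAdjoint.star_eq }
  ck1_orth a b hab := Subtype.ext <| lp.ext <| funext fun P => P.isCK.ck1_orth a b hab
  ck2 g f := Subtype.ext <| lp.ext <| funext fun P => P.isCK.ck2 g f
  ck3 f := Subtype.ext <| lp.ext <| funext fun P => P.isCK.ck3 f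
  ck4 a n := by
    have : Fintype (G.PathTo a n) := Fintype.ofFinite _
    rw [finsum_mem_pathsInto]
    refine Subtype.ext <| lp.ext <| funext fun P => ?_
    rw [AddSubmonoidClass.coe_finsetSum, lp.coeFn_sum, Finset.sum_apply]
    exact (P.isCK.ck4 a n).trans (finsum_mem_pathsInto _)

theorem dense_adjoin_gen : Dense (NonUnitalStarAlgebra.adjoin ℂ (Set.range (gen.{u, v, w} G)) :
    Set (CStarAlg.{u, v, w} G)) := by
  have h_image : Subtype.val '' (NonUnitalStarAlgebra.adjoin ℂ (Set.range (gen.{u, v, w} G)) :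
      Set (CStarAlg.{u, v, w} G)) =
      NonUnitalStarAlgebra.adjoin ℂ (Set.range (universalFamily.{u, v, w} G)) := by
    have h_map := NonUnitalStarAlgHom.map_adjoin
      (NonUnitalStarSubalgebraClass.subtype (cstarSubalgebra.{u, v, w} G))
      (Set.range (gen.{u, v, w} G))
    rw [← Set.range_comp] at h_map
    exact congrArg SetLike.coe h_map
  exact Subtype.dense_iff.2 fun x hx => h_image.symm ▸ hx

theorem dense_adjoin_edges [∀ a n, Finite (G.PathTo a n)] (i₀ : Fin k) :
    Dense (NonUnitalStarAlgebra.adjoin ℂ {x | ∃ i, ∃ f : G.Edge i, x = gen.{u, v, w} G f.1} :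
      Set (CStarAlg.{u, v, w} G)) := by
  refine dense_adjoin_gen.mono (NonUnitalStarAlgebra.adjoin_le ?_)
  rintro _ ⟨l, rfl⟩
  refine isCKFamily_gen.mem_of_edge_mem i₀ (fun i f => ?_) l.hom
  exact NonUnitalStarAlgebra.subset_adjoin ℂ _ ⟨i, f, rfl⟩

variable {A : Type*} [NonUnitalCStarAlgebra A]

theorem starAlgHom_ext [∀ a n, Finite (G.PathTo a n)] (i₀ : Fin k)
    {π π' : CStarAlg.{u, v, w} G →⋆ₙₐ[ℂ] A}
    (h : ∀ i (f : G.Edge i), π (G.gen f.1) = π' (G.gen f.1)) : π = π' := by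
  have h_adjoin : NonUnitalStarAlgebra.adjoin ℂ
      {x | ∃ i, ∃ f : G.Edge i, x = gen.{u, v, w} G f.1} ≤ NonUnitalStarAlgHom.equalizer π π' := by
    refine NonUnitalStarAlgebra.adjoin_le ?_
    rintro _ ⟨i, f, rfl⟩
    exact h i f
  exact DFunLike.coe_injective (Continuous.ext_on (dense_adjoin_edges i₀) (map_continuous π)
    (map_continuous π') h_adjoin)

theorem closure_range_starAlgHom [∀ a n, Finite (G.PathTo a n)] (i₀ : Fin k)
    (π : CStarAlg.{u, v, w} G →⋆ₙₐ[ℂ] A) :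
    closure (Set.range π) =
      closure (NonUnitalStarAlgebra.adjoin ℂ {T | ∃ i, ∃ f : G.Edge i, T = π (G.gen f.1)} :
        Set A) := by
  have h_image : π '' {x | ∃ i, ∃ f : G.Edge i, x = G.gen f.1} =
      {T | ∃ i, ∃ f : G.Edge i, T = π (G.gen f.1)} := by
    aesop
  rw [← h_image, ← NonUnitalStarAlgHom.map_adjoin, NonUnitalStarSubalgebra.coe_map]
  exact subset_antisymm (closure_minimal
    ((map_continuous π).range_subset_closure_image_dense (dense_adjoin_edges i₀)) isClosed_closure)
    (closure_mono (Set.image_subset_range _ _))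

end Representation

end HigherRankGraph

/-! ### Semibranching systems on `k`-graphs -/

section SemibranchingSystems

variable {X : Type w} [MeasurableSpace X] {μ : Measure X}

namespace IsCodingMap

variable {ι : Type v} {D : ι → Set X} {σ : ι → X → X} {c : X → X}

/-- The branch `σ j : D j → X` of a family with coding map `c` as a partial bijection onto its
range, the inverse of which is `c`. -/
def partialEquiv (h : IsCodingMap D σ c) (j : ι) : PartialEquiv X X where
  toFun := σ j
  invFun := c
  source := D j
  target := σ j '' D j
  map_source' _ hx := Set.mem_image_of_mem _ hx
  map_target' := by
    rintro _ ⟨x, hx, rfl⟩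
    rwa [h.apply_map j x hx]
  left_inv' x hx := h.apply_map j x hx
  right_inv' := by
    rintro _ ⟨x, hx, rfl⟩
    rw [h.apply_map j x hx]

theorem isNonsingular_partialEquiv {Φ : ι → X → ℝ} (h : IsCodingMap D σ c)
    (hσ : IsSemibranching μ D σ Φ) (j : ι) : IsNonsingular μ μ (h.partialEquiv j) (Φ j) where
  measurableSet_source := hσ.measurableSet_dom j
  measurableSet_target :=
    (hσ.rnDeriv j).measurableSet_image _ subset_rfl (hσ.measurableSet_dom j)
  measurable_toFun := hσ.measurable_map j
  measurable_symm := h.measurable.comp measurable_subtype_coe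
  aemeasurable_deriv := (hσ.rnDeriv j).measurable.aemeasurable
  deriv_pos := (ae_restrict_iff' (hσ.measurableSet_dom j)).2 (hσ.rnDeriv_pos j)
  map_symm := by
    refine Measure.ext fun s hs => ?_
    have h_image : σ j '' (s ∩ D j) = c ⁻¹' s ∩ σ j '' D j := by
      rw [Set.inter_comm, Set.inter_comm _ (σ j '' D j)]
      exact (h.partialEquiv j).image_source_inter_eq' s
    have h_meas : MeasurableSet (s ∩ D j) := hs.inter (hσ.measurableSet_dom j)
    calc (μ.restrict (σ j '' D j)).map c s
        = μ (σ j '' (s ∩ D j)) := by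
          rw [Measure.map_apply h.measurable hs, Measure.restrict_apply (h.measurable hs), h_image]
      _ = ∫⁻ x in s ∩ D j, ENNReal.ofReal (Φ j x) ∂μ :=
          (hσ.rnDeriv j).measure_image _ Set.inter_subset_right h_meas
      _ = (μ.restrict (D j)).withDensity (fun x => ENNReal.ofReal (Φ j x)) s := by
          rw [withDensity_apply _ hs, Measure.restrict_restrict hs]

end IsCodingMap

end SemibranchingSystems

section EdgeSystems

open HigherRankGraph

/-- Nonsingular partial bijections of a measure space, indexed by the edges of a `k`-graph, whose
operators on `L²` form a Cuntz–Krieger family: up to null sets, the sources depend only on the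
source vertex of the edge and are partitioned by the targets of the edges of each colour into that
vertex, and the partial bijections commute on squares. -/
structure IsNonsingularEdgeSystem {k : ℕ} {Λ : Type u} [Category.{v} Λ] (G : HigherRankGraph k Λ)
    {X : Type w} [MeasurableSpace X] (μ : Measure X) (e : ∀ i, G.Edge i → PartialEquiv X X)
    (Φ : ∀ i, G.Edge i → X → ℝ) : Prop where
  nonsingular : ∀ i f, IsNonsingular μ μ (e i f) (Φ i f)
  aedisjoint_target : ∀ i, Pairwise fun f g => AEDisjoint μ (e i f).target (e i g).target
  source_ae_eq : ∀ i j (f : G.Edge i),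
    (e i f).source =ᵐ[μ] ⋃ g : G.PathTo f.1.left (basisVec j), (e j g.edge).target
  trans_eqOnSource : ∀ (i j : Fin k) {a b b' d : Λ} (lam : b ⟶ d) (α : a ⟶ b) (ν : b' ⟶ d)
    (β : a ⟶ b') (hlam : Arrow.mk lam ∈ G.pathsOfDeg (basisVec i))
    (hα : Arrow.mk α ∈ G.pathsOfDeg (basisVec j)) (hν : Arrow.mk ν ∈ G.pathsOfDeg (basisVec j))
    (hβ : Arrow.mk β ∈ G.pathsOfDeg (basisVec i)), α ≫ lam = β ≫ ν →
      (e j ⟨_, hα⟩).trans (e i ⟨_, hlam⟩) ≈ (e i ⟨_, hβ⟩).trans (e j ⟨_, hν⟩)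

variable {k : ℕ} {Λ : Type u} [Category.{v} Λ] {G : HigherRankGraph k Λ}
  {X : Type w} [MeasurableSpace X] {μ : Measure X}

theorem IsNonsingularEdgeSystem.isEdgeCKFamily [∀ a n, Fintype (G.PathTo a n)]
    {e : ∀ i, G.Edge i → PartialEquiv X X} {Φ : ∀ i, G.Edge i → X → ℝ}
    (h : IsNonsingularEdgeSystem G μ e Φ)
    (𝕜 E : Type*) [RCLike 𝕜] [NormedAddCommGroup E] [InnerProductSpace 𝕜 E] [CompleteSpace E] :
    IsEdgeCKFamily fun i f => (h.nonsingular i f).operator 𝕜 E where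
  partialIsometry i f := by
    rw [ContinuousLinearMap.star_eq_adjoint, IsNonsingular.adjoint_operator, mul_assoc]
    exact (h.nonsingular i f).operator_comp_operator_symm_comp_operator
  star_mul_self i j f := by
    simp only [ContinuousLinearMap.star_eq_adjoint, IsNonsingular.adjoint_operator]
    refine (h.nonsingular i f).operator_symm_comp_operator.trans ?_
    rw [IsNonsingular.operator_ofSet_eq_sum (h.nonsingular i f).measurableSet_source
      (fun g : G.PathTo f.1.left (basisVec j) => (h.nonsingular j g.edge).measurableSet_target)
      (fun g g' hg => h.aedisjoint_target j fun h_edge =>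
        hg (PathTo.arrow_injective (congrArg Subtype.val h_edge))) (h.source_ae_eq i j f)]
    refine Finset.sum_congr rfl fun g _ => ?_
    exact (h.nonsingular j g.edge).operator_comp_operator_symm.symm
  star_mul_of_ne i f g hfg :=
    (h.nonsingular i f).adjoint_operator_comp_eq_zero (h.nonsingular i g)
      (h.aedisjoint_target i hfg)
  commutesOnSquares i j _ _ _ _ lam α ν β hlam hα hν hβ h_comp :=
    ((h.nonsingular j ⟨_, hα⟩).operator_trans (h.nonsingular i ⟨_, hlam⟩)).symm.trans <|
      (IsNonsingular.operator_congr _ _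
        (h.trans_eqOnSource i j lam α ν β hlam hα hν hβ h_comp)).trans <|
      (h.nonsingular i ⟨_, hβ⟩).operator_trans (h.nonsingular j ⟨_, hν⟩)

namespace IsEdgeSemibranching

variable {D : ∀ i, G.Edge i → Set X} {τ : ∀ i, G.Edge i → X → X} {Φ : ∀ i, G.Edge i → X → ℝ}
  {c : Fin k → X → X} {DV : Λ → Set X} (h : IsEdgeSemibranching G μ D τ Φ c DV)
include h

theorem image_subset {i j : Fin k} (f : G.Edge i) (g : G.PathTo f.1.left (basisVec j)) :
    τ j g.edge '' D j g.edge ⊆ DV f.1.left := by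
  obtain ⟨b, β, ν, h_comp, hν, hβ⟩ : ∃ (b : Λ) (β : g.source ⟶ b) (ν : b ⟶ f.1.right),
      β ≫ ν = g.hom ≫ f.1.hom ∧ G.deg (Arrow.mk ν) = basisVec j ∧
        G.deg (Arrow.mk β) = basisVec i :=
    G.exists_comp_eq (by rw [G.deg_comp, g.deg_hom, add_comm]; exact congrArg (_ + ·) f.2)
  rw [← h.cond_i_dom i f]
  exact (h.cond_iii i j f.1.hom g.hom ν β f.2 g.deg_hom hν hβ h_comp.symm).1

theorem source_ae_eq {i : Fin k} (j : Fin k) (f : G.Edge i) :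
    D i f =ᵐ[μ] ⋃ g : G.PathTo f.1.left (basisVec j), τ j g.edge '' D j g.edge := by
  rw [h.cond_i_dom i f]
  have h_cover : (⋃ g : {g : G.Edge j // g.1.right = f.1.left}, τ j g.1 '' D j g.1) ⊆
      ⋃ g : G.PathTo f.1.left (basisVec j), τ j g.edge '' D j g.edge := by
    refine Set.iUnion_subset fun ⟨⟨⟨b, _, g⟩, hg⟩, h_range⟩ => ?_
    cases h_range
    exact Set.subset_iUnion_of_subset ⟨b, g, hg⟩ subset_rfl
  exact ((ae_le_set.2 (h.cond_v f.1.left j)).trans h_cover.eventuallyLE).antisymm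
    (Set.iUnion_subset (h.image_subset f)).eventuallyLE

theorem isNonsingularEdgeSystem :
    IsNonsingularEdgeSystem G μ (fun i f => (h.coding i).partialEquiv f) Φ where
  nonsingular i f := (h.coding i).isNonsingular_partialEquiv (h.semibranching i) f
  aedisjoint_target i f g hfg := (h.semibranching i).disjoint f g hfg
  source_ae_eq _ j f := h.source_ae_eq j f
  trans_eqOnSource i j _ _ _ _ lam α ν β hlam hα hν hβ h_comp := by
    obtain ⟨h_sub, h_sub', h_eq⟩ := h.cond_iii i j lam α ν β hlam hα hν hβ h_comp
    have h_source : D j ⟨_, hα⟩ ∩ τ j ⟨_, hα⟩ ⁻¹' D i ⟨_, hlam⟩ = D j ⟨_, hα⟩ :=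
      Set.inter_eq_left.2 (Set.image_subset_iff.1 h_sub)
    have h_source' : D i ⟨_, hβ⟩ ∩ τ i ⟨_, hβ⟩ ⁻¹' D j ⟨_, hν⟩ = D i ⟨_, hβ⟩ :=
      Set.inter_eq_left.2 (Set.image_subset_iff.1 h_sub')
    have h_dom : D j ⟨_, hα⟩ = D i ⟨_, hβ⟩ := (h.cond_i_dom j _).trans
      (h.cond_i_dom i ⟨Arrow.mk β, hβ⟩).symm
    exact ⟨h_source.trans (h_dom.trans h_source'.symm), fun x hx => h_eq x hx.1⟩

end IsEdgeSemibranching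

end EdgeSystems

theorem mainTheorem10_general {k : ℕ} (hk : 1 ≤ k) {Λ : Type u} [Category.{v} Λ]
    (G : HigherRankGraph k Λ) (hrow : G.IsRowFinite) {X : Type w} [MeasurableSpace X]
    (μ : Measure X) (e : ∀ i, G.Edge i → PartialEquiv X X) (Φ : ∀ i, G.Edge i → X → ℝ)
    (hsys : IsNonsingularEdgeSystem G μ e Φ) :
    ∃ π : HigherRankGraph.CStarAlg.{u, v, w} G →⋆ₙₐ[ℂ] (Lp ℂ 2 μ →L[ℂ] Lp ℂ 2 μ),
      (∀ (i : Fin k) (f : G.Edge i), π (G.gen f.1) = (hsys.nonsingular i f).operator ℂ ℂ) ∧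
      (∀ π' : HigherRankGraph.CStarAlg.{u, v, w} G →⋆ₙₐ[ℂ] (Lp ℂ 2 μ →L[ℂ] Lp ℂ 2 μ),
        (∀ (i : Fin k) (f : G.Edge i), π' (G.gen f.1) = (hsys.nonsingular i f).operator ℂ ℂ) →
          π' = π) ∧
      closure (Set.range π) =
        closure (NonUnitalStarAlgebra.adjoin ℂ
          {T | ∃ i f, T = (hsys.nonsingular i f).operator ℂ ℂ} :
            Set (Lp ℂ 2 μ →L[ℂ] Lp ℂ 2 μ)) := by
  have hfinite := hrow.finite_pathTo
  have : ∀ a n, Fintype (G.PathTo a n) := fun a n => Fintype.ofFinite _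
  have i₀ : Fin k := ⟨0, hk⟩
  have hS := hsys.isEdgeCKFamily ℂ ℂ
  have hπ : ∀ i (f : G.Edge i),
      HigherRankGraph.liftCK (hS.isCKFamily i₀) (G.gen f.1) = (hsys.nonsingular i f).operator ℂ ℂ :=
    fun i f => (HigherRankGraph.liftCK_gen _ _).trans (hS.pathFamily_edge i₀ f)
  refine ⟨HigherRankGraph.liftCK (hS.isCKFamily i₀), hπ, fun π' hπ' => ?_, ?_⟩
  · exact HigherRankGraph.starAlgHom_ext i₀ fun i f => (hπ' i f).trans (hπ i f).symm
  · simpa only [hπ] using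
      HigherRankGraph.closure_range_starAlgHom i₀ (HigherRankGraph.liftCK (hS.isCKFamily i₀))

theorem mainTheorem10 {k : ℕ} (hk : 1 ≤ k) {Λ : Type u} [Category.{v} Λ]
    (G : HigherRankGraph k Λ) (hfin : G.IsFinite) (hns : G.NoSources)
    {X : Type w} [MeasurableSpace X] (μ : Measure X)
    (D : ∀ i, G.Edge i → Set X) (τ : ∀ i, G.Edge i → X → X) (Φ : ∀ i, G.Edge i → X → ℝ)
    (c : Fin k → X → X) (DV : Λ → Set X)
    (hsys : IsEdgeSemibranching G μ D τ Φ c DV) :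
    ∃ S : ∀ i, G.Edge i → (Lp ℂ 2 μ →L[ℂ] Lp ℂ 2 μ),
      (∀ (i : Fin k) (f : G.Edge i) (ξ : Lp ℂ 2 μ),
        (S i f ξ : X → ℂ) =ᵐ[μ] (τ i f '' D i f).indicator
          (fun x => ((Φ i f (c i x) ^ (-(1 / 2) : ℝ) : ℝ) : ℂ) * ξ (c i x))) ∧
      ∃ π : HigherRankGraph.CStarAlg.{u, v, w} G →⋆ₙₐ[ℂ] (Lp ℂ 2 μ →L[ℂ] Lp ℂ 2 μ),
        (∀ (i : Fin k) (f : G.Edge i), π (G.gen f.1) = S i f) ∧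
        (∀ π' : HigherRankGraph.CStarAlg.{u, v, w} G →⋆ₙₐ[ℂ] (Lp ℂ 2 μ →L[ℂ] Lp ℂ 2 μ),
          (∀ (i : Fin k) (f : G.Edge i), π' (G.gen f.1) = S i f) → π' = π) ∧
        closure (Set.range π) =
          closure (NonUnitalStarAlgebra.adjoin ℂ {T | ∃ i f, T = S i f} :
            Set (Lp ℂ 2 μ →L[ℂ] Lp ℂ 2 μ)) := by
  refine ⟨fun i f => (hsys.isNonsingularEdgeSystem.nonsingular i f).operator ℂ ℂ, fun i f ξ => ?_,
    mainTheorem10_general hk G hfin.isRowFinite μ _ Φ hsys.isNonsingularEdgeSystem⟩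
  exact (hsys.isNonsingularEdgeSystem.nonsingular i f).coeFn_operator ξ
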